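/- Let $n \ge 1$, let $\Omega \subseteq \mathbb{R}^n$ be a bounded open set, let $1 < p < \infty$, let $\mathbb{K}$ be $\mathbb{R}$ or $\mathbb{C}$, and let $\gamma \in L^\infty(\Omega)$ be a positive function, meaning that $\gamma$ is real valued and there is a constant $c > 0$ with $\gamma \ge c$ almost everywhere in $\Omega$. Let $W^{1,p}(\Omega;\mathbb{K})$ be the Sobolev space with norm $\|u\|_{W^{1,p}} = (\|u\|_{L^p}^p + \|\nabla u\|_{L^p}^p)^{1/p}$, and let $W^{1,p}_0(\Omega;\mathbb{K})$ be the closure of $C_c^\infty(\Omega;\mathbb{K})$ in it. For $f \in W^{1,p}(\Omega;\mathbb{K})$, a weak solution of the Dirichlet problem $$\mathrm{div}(\gamma |\nabla u|^{p-2} \nabla u) = 0 \ \text{ in } \Omega, \qquad u = f \ \text{ on } \partial\Omega,$$ is a function $u \in W^{1,p}(\Omega;\mathbb{K})$ with $u - f \in W^{1,p}_0(\Omega;\mathbb{K})$ and $$\int_\Omega \gamma |\nabla u|^{p-2} \nabla u \cdot \nabla \varphi \, dx = 0 \quad \text{for all } \varphi \in W^{1,p}_0(\Omega;\mathbb{K}),$$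 where $z \cdot w = \sum_j z_j w_j$ and $|\nabla u|^{p-2}\nabla u$ is $0$ where $\nabla u = 0$. Then there is a constant $C > 0$, independent of $f$, such that for every $f \in W^{1,p}(\Omega;\mathbb{K})$ this Dirichlet problem has a unique weak solution $u \in W^{1,p}(\Omega;\mathbb{K})$, and $$\|u\|_{W^{1,p}} \le C \|f\|_{W^{1,p}}.$$ Moreover, $u$ is the unique minimizer of the energy $E(v) = \int_\Omega \gamma |\nabla v|^p \, dx$ among all $v \in W^{1,p}(\Omega;\mathbb{K})$ with $v - f \in W^{1,p}_0(\Omega;\mathbb{K})$. -/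

import Mathlib

open MeasureTheory
open scoped ENNReal ContDiff

noncomputable section

namespace WeightedPLaplace

variable {𝕜 : Type*} [RCLike 𝕜] {n : ℕ}

/-- The vector field `g` is the weak gradient of `u` in `Ω`: for all real test functions
`φ ∈ C_c^∞(Ω)` and all `i`, `∫_Ω u ∂ᵢφ = - ∫_Ω gᵢ φ`. (Used for `u` and `g` in `L^p(Ω)`,
where both integrands are integrable.) -/
def HasWeakGradient (Ω : Set (EuclideanSpace ℝ (Fin n))) (u : EuclideanSpace ℝ (Fin n) → 𝕜)
    (g : EuclideanSpace ℝ (Fin n) → EuclideanSpace 𝕜 (Fin n)) : Prop :=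
  ∀ φ : EuclideanSpace ℝ (Fin n) → ℝ, ContDiff ℝ ∞ φ → HasCompactSupport φ → tsupport φ ⊆ Ω →
    ∀ i : Fin n,
      ∫ x in Ω, fderiv ℝ φ x (EuclideanSpace.single i 1) • u x = - ∫ x in Ω, φ x • g x i

/-- Pairs `(u, g)` with `u ∈ L^p(Ω; 𝕜)` and `g ∈ L^p(Ω; 𝕜ⁿ)`, with the norm
`(‖u‖_p ^ p + ‖g‖_p ^ p) ^ (1 / p)`; here `|g(x)|` is the Euclidean norm on `𝕜ⁿ`. -/
abbrev LpPair (𝕜 : Type*) [RCLike 𝕜] (Ω : Set (EuclideanSpace ℝ (Fin n))) (p : ℝ≥0∞) : Type _ :=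
  WithLp p (Lp 𝕜 p (volume.restrict Ω) × Lp (EuclideanSpace 𝕜 (Fin n)) p (volume.restrict Ω))

lemma integrable_smul_of_memLp {F : Type*} [NormedAddCommGroup F] [NormedSpace ℝ F]
    {Ω : Set (EuclideanSpace ℝ (Fin n))} {p : ℝ≥0∞} (hp : 1 ≤ p)
    {φ : EuclideanSpace ℝ (Fin n) → ℝ} (hφ : Continuous φ) (hc : HasCompactSupport φ)
    {u : EuclideanSpace ℝ (Fin n) → F} (hu : MemLp u p (volume.restrict Ω)) :
    Integrable (fun x => φ x • u x) (volume.restrict Ω) :=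
  (hu.locallyIntegrable hp).integrable_smul_left_of_hasCompactSupport hφ hc

lemma continuous_partial {φ : EuclideanSpace ℝ (Fin n) → ℝ} (hφ : ContDiff ℝ ∞ φ)
    (v : EuclideanSpace ℝ (Fin n)) : Continuous (fun x => fderiv ℝ φ x v) :=
  (hφ.continuous_fderiv (by simp)).clm_apply continuous_const

lemma hasCompactSupport_partial {φ : EuclideanSpace ℝ (Fin n) → ℝ} (hc : HasCompactSupport φ)
    (v : EuclideanSpace ℝ (Fin n)) : HasCompactSupport (fun x => fderiv ℝ φ x v) :=
  (hc.fderiv ℝ).comp_left (g := fun L : EuclideanSpace ℝ (Fin n) →L[ℝ] ℝ => L v) (by simp)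

lemma memLp_coord {Ω : Set (EuclideanSpace ℝ (Fin n))} {p : ℝ≥0∞}
    (g : Lp (EuclideanSpace 𝕜 (Fin n)) p (volume.restrict Ω)) (i : Fin n) :
    MemLp (fun x => g x i) p (volume.restrict Ω) :=
  (EuclideanSpace.proj i : EuclideanSpace 𝕜 (Fin n) →L[𝕜] 𝕜).comp_memLp g

/-- The Sobolev space `W^{1,p}(Ω; 𝕜)`: a function `u ∈ L^p(Ω; 𝕜)` together with its weak gradient
in `L^p(Ω; 𝕜ⁿ)` (which is determined by `u`, see `sobolev_ext`), with the norm
`(‖u‖_p ^ p + ‖∇u‖_p ^ p) ^ (1 / p)`. -/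
def Sobolev (𝕜 : Type*) [RCLike 𝕜] (Ω : Set (EuclideanSpace ℝ (Fin n))) (p : ℝ≥0∞)
    [hp : Fact (1 ≤ p)] : Submodule 𝕜 (LpPair 𝕜 Ω p) where
  carrier := {w | HasWeakGradient Ω (w.fst : EuclideanSpace ℝ (Fin n) → 𝕜)
    (w.snd : EuclideanSpace ℝ (Fin n) → EuclideanSpace 𝕜 (Fin n))}
  zero_mem' := by
    intro φ _ _ _ i
    have h1 : ∫ x in Ω, fderiv ℝ φ x (EuclideanSpace.single i 1) •
        ((0 : LpPair 𝕜 Ω p).fst : EuclideanSpace ℝ (Fin n) → 𝕜) x = 0 := by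
      apply integral_eq_zero_of_ae
      filter_upwards [Lp.coeFn_zero 𝕜 p (volume.restrict Ω)] with x hx
      rw [WithLp.zero_fst, hx]
      simp
    have h2 : ∫ x in Ω, φ x • ((0 : LpPair 𝕜 Ω p).snd :
        EuclideanSpace ℝ (Fin n) → EuclideanSpace 𝕜 (Fin n)) x i = 0 := by
      apply integral_eq_zero_of_ae
      filter_upwards [Lp.coeFn_zero (EuclideanSpace 𝕜 (Fin n)) p (volume.restrict Ω)] with x hx
      rw [WithLp.zero_snd, hx]
      simp
    rw [h1, h2, neg_zero]
  add_mem' := by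
    intro a b ha hb φ hφ hc hs i
    have h1 := ha φ hφ hc hs i
    have h2 := hb φ hφ hc hs i
    have e1 : ∫ x in Ω, fderiv ℝ φ x (EuclideanSpace.single i 1) •
        ((a + b).fst : EuclideanSpace ℝ (Fin n) → 𝕜) x =
        (∫ x in Ω, fderiv ℝ φ x (EuclideanSpace.single i 1) • a.fst x) +
        ∫ x in Ω, fderiv ℝ φ x (EuclideanSpace.single i 1) • b.fst x := by
      rw [← integral_add
        (integrable_smul_of_memLp hp.out (continuous_partial hφ _)
          (hasCompactSupport_partial hc _) (Lp.memLp a.fst))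
        (integrable_smul_of_memLp hp.out (continuous_partial hφ _)
          (hasCompactSupport_partial hc _) (Lp.memLp b.fst))]
      apply integral_congr_ae
      filter_upwards [Lp.coeFn_add a.fst b.fst] with x hx
      simp only [WithLp.add_fst, hx, Pi.add_apply, smul_add]
    have e2 : ∫ x in Ω, φ x • ((a + b).snd :
        EuclideanSpace ℝ (Fin n) → EuclideanSpace 𝕜 (Fin n)) x i =
        (∫ x in Ω, φ x • a.snd x i) + ∫ x in Ω, φ x • b.snd x i := by
      rw [← integral_add
        (integrable_smul_of_memLp hp.out hφ.continuous hc (memLp_coord a.snd i))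
        (integrable_smul_of_memLp hp.out hφ.continuous hc (memLp_coord b.snd i))]
      apply integral_congr_ae
      filter_upwards [Lp.coeFn_add a.snd b.snd] with x hx
      simp only [WithLp.add_snd, hx, Pi.add_apply, PiLp.add_apply, smul_add]
    rw [e1, e2, h1, h2]
    ring
  smul_mem' := by
    intro c a ha φ hφ hc hs i
    have h1 := ha φ hφ hc hs i
    have e1 : ∫ x in Ω, fderiv ℝ φ x (EuclideanSpace.single i 1) •
        ((c • a).fst : EuclideanSpace ℝ (Fin n) → 𝕜) x =
        c • ∫ x in Ω, fderiv ℝ φ x (EuclideanSpace.single i 1) • a.fst x := by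
      rw [← integral_smul]
      apply integral_congr_ae
      filter_upwards [Lp.coeFn_smul c a.fst] with x hx
      simp only [WithLp.smul_fst, hx, Pi.smul_apply]
      rw [smul_comm]
    have e2 : ∫ x in Ω, φ x • ((c • a).snd :
        EuclideanSpace ℝ (Fin n) → EuclideanSpace 𝕜 (Fin n)) x i =
        c • ∫ x in Ω, φ x • a.snd x i := by
      rw [← integral_smul]
      apply integral_congr_ae
      filter_upwards [Lp.coeFn_smul c a.snd] with x hx
      simp only [WithLp.smul_snd, hx, Pi.smul_apply, PiLp.smul_apply]
      rw [smul_comm]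
    rw [e1, e2, h1, smul_neg]

section

variable {Ω : Set (EuclideanSpace ℝ (Fin n))} {p : ℝ≥0∞} [Fact (1 ≤ p)]

/-- The underlying element of `L^p(Ω; 𝕜)`. -/
def toLp (u : Sobolev 𝕜 Ω p) : Lp 𝕜 p (volume.restrict Ω) := u.1.fst

/-- The weak gradient `∇u ∈ L^p(Ω; 𝕜ⁿ)`. -/
def grad (u : Sobolev 𝕜 Ω p) : Lp (EuclideanSpace 𝕜 (Fin n)) p (volume.restrict Ω) := u.1.snd

/-- On an open set, an element of `W^{1,p}(Ω; 𝕜)` is determined by its underlying function. -/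
lemma sobolev_ext (hΩ : IsOpen Ω) {u v : Sobolev 𝕜 Ω p} (h : toLp u = toLp v) : u = v := by
  have key : grad u = grad v := by
    have hall : ∀ i : Fin n, ∀ᵐ x, x ∈ Ω → grad u x i - grad v x i = 0 := by
      intro i
      have hl : LocallyIntegrable (fun x => grad u x i - grad v x i) (volume.restrict Ω) :=
        ((memLp_coord (grad u) i).sub (memLp_coord (grad v) i)).locallyIntegrable Fact.out
      refine hΩ.ae_eq_zero_of_integral_contDiff_smul_eq_zero (μ := volume)
        (f := fun x => grad u x i - grad v x i) ?_ ?_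
      · rw [locallyIntegrableOn_iff hΩ.isLocallyClosed]
        intro k hk hkc
        have := hl.integrableOn_isCompact hkc
        rwa [IntegrableOn, Measure.restrict_restrict hkc.measurableSet,
          Set.inter_eq_self_of_subset_left hk] at this
      · intro φ hφ hc hs
        have h1 := u.2 φ hφ hc hs i
        have h2 := v.2 φ hφ hc hs i
        have h3 : u.1.fst = v.1.fst := h
        rw [h3, h2, neg_inj] at h1
        have hz : ∀ x, x ∉ Ω → φ x • (grad u x i - grad v x i) = 0 := by
          intro x hx
          have : φ x = 0 := image_eq_zero_of_notMem_tsupport (fun hm => hx (hs hm))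
          simp [this]
        rw [← setIntegral_eq_integral_of_forall_compl_eq_zero hz]
        simp only [smul_sub]
        rw [integral_sub
          (integrable_smul_of_memLp Fact.out hφ.continuous hc (memLp_coord (grad u) i))
          (integrable_smul_of_memLp Fact.out hφ.continuous hc (memLp_coord (grad v) i))]
        exact sub_eq_zero.mpr h1.symm
    apply Lp.ext
    filter_upwards [(ae_restrict_iff' hΩ.measurableSet).mpr (ae_all_iff.mpr hall |>.mono
      fun x hx hxΩ i => hx i hxΩ)] with x hx
    ext i
    exact sub_eq_zero.mp (hx i)
  apply Subtype.ext
  exact (WithLp.ofLp_injective p) (Prod.ext h key)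

end

/-- The elements of `W^{1,p}(Ω; 𝕜)` that are given by a function in `C_c^∞(Ω; 𝕜)`. -/
def smoothCompact (𝕜 : Type*) [RCLike 𝕜] (Ω : Set (EuclideanSpace ℝ (Fin n))) (p : ℝ≥0∞)
    [Fact (1 ≤ p)] : Submodule 𝕜 (Sobolev 𝕜 Ω p) where
  carrier := {w | ∃ φ : EuclideanSpace ℝ (Fin n) → 𝕜, ContDiff ℝ ∞ φ ∧ HasCompactSupport φ ∧
    tsupport φ ⊆ Ω ∧ toLp w =ᵐ[volume.restrict Ω] φ}
  zero_mem' := ⟨0, contDiff_const, HasCompactSupport.zero, by simp,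
    Lp.coeFn_zero 𝕜 p (volume.restrict Ω)⟩
  add_mem' := by
    rintro a b ⟨φ, h1, h2, h3, h4⟩ ⟨ψ, k1, k2, k3, k4⟩
    refine ⟨φ + ψ, h1.add k1, h2.add k2,
      (tsupport_add φ ψ).trans (Set.union_subset h3 k3), ?_⟩
    exact (Lp.coeFn_add (toLp a) (toLp b)).trans (h4.add k4)
  smul_mem' := by
    rintro c a ⟨φ, h1, h2, h3, h4⟩
    refine ⟨c • φ, h1.const_smul c, h2.smul_left (f := fun _ => c),
      (closure_mono (Function.support_const_smul_subset c φ)).trans h3, ?_⟩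
    exact (Lp.coeFn_smul c (toLp a)).trans (h4.const_smul c)

/-- `W^{1,p}_0(Ω; 𝕜)`, the closure of `C_c^∞(Ω; 𝕜)` in `W^{1,p}(Ω; 𝕜)`. -/
def Sobolev₀ (𝕜 : Type*) [RCLike 𝕜] (Ω : Set (EuclideanSpace ℝ (Fin n))) (p : ℝ≥0∞)
    [Fact (1 ≤ p)] : Submodule 𝕜 (Sobolev 𝕜 Ω p) :=
  (smoothCompact 𝕜 Ω p).topologicalClosure

section

variable {Ω : Set (EuclideanSpace ℝ (Fin n))} {p : ℝ≥0∞} [Fact (1 ≤ p)]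

/-- `u` is a weak solution of the Dirichlet problem `div(γ |∇u|^{p-2} ∇u) = 0` in `Ω`, `u = f` on
`∂Ω`: `u - f ∈ W^{1,p}_0(Ω; 𝕜)` and `∫_Ω γ |∇u|^{p-2} ∇u · ∇φ = 0` for all
`φ ∈ W^{1,p}_0(Ω; 𝕜)`, with the bilinear dot product. The vector `|∇u|^{p-2} ∇u` is `0` where
`∇u = 0`. -/
def IsWeakSolution (γ : EuclideanSpace ℝ (Fin n) → ℝ) (f u : Sobolev 𝕜 Ω p) : Prop :=
  u - f ∈ Sobolev₀ 𝕜 Ω p ∧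
    ∀ φ ∈ Sobolev₀ 𝕜 Ω p,
      ∫ x in Ω, (γ x * ‖grad u x‖ ^ (p.toReal - 2)) • ∑ i, grad u x i * grad φ x i = 0

/-- The energy `E(v) = ∫_Ω γ |∇v|^p`. -/
def energy (γ : EuclideanSpace ℝ (Fin n) → ℝ) (v : Sobolev 𝕜 Ω p) : ℝ :=
  ∫ x in Ω, γ x * ‖grad v x‖ ^ p.toReal

/-- `u` minimizes the energy among all `v ∈ W^{1,p}(Ω; 𝕜)` with `v - f ∈ W^{1,p}_0(Ω; 𝕜)`. -/
def IsEnergyMinimizer (γ : EuclideanSpace ℝ (Fin n) → ℝ) (f u : Sobolev 𝕜 Ω p) : Prop :=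
  u - f ∈ Sobolev₀ 𝕜 Ω p ∧
    ∀ v : Sobolev 𝕜 Ω p, v - f ∈ Sobolev₀ 𝕜 Ω p → energy γ u ≤ energy γ v

end

end WeightedPLaplace

end

open WeightedPLaplace

/-! ### Pointwise convexity of the `q`-th power of a norm. -/

section Pointwise

variable {E : Type*} [NormedAddCommGroup E] {q : ℝ}

/-! The equation is the Euler-Lagrange equation of a strictly convex energy, so weak solutions and
minimizers are the same objects (`isWeakSolution_iff_isEnergyMinimizer`). Existence and uniqueness
are proved for minimizers and then transferred.

Compactness comes from a quantitative strict convexity of `‖·‖ ^ q` (`exists_norm_sub_rpow_le`),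
obtained for all `q > 1` at once from compactness and homogeneity, without Clarkson inequalities.
Integrated against `γ`, it makes minimizing sequences of gradients Cauchy in `L^p`, so neither
reflexivity nor weak convergence is needed (`exists_weightedEnergy_minimal`). The Poincaré
inequality (`exists_norm_toLp_le_norm_grad`) makes the set of admissible gradients closed and lets a
gradient determine its function once the boundary values are fixed.

The tangent inequality for `‖·‖ ^ q` (`norm_rpow_gradient_le`) gives both directions of the
equivalence. The norm bound follows by comparing the energies of `u` and `f` and applying Poincaré
to `u - f`. -/

lemma continuous_norm_rpow_of_pos (hq : 0 < q) : Continuous fun a : E => ‖a‖ ^ q :=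
  continuous_norm.rpow_const fun _ => Or.inr hq.le

/-- Convexity of `r ^ q` applied to `a = b + (a - b)` with weights `t` and `1 - t`. The coefficient
of `‖b‖ ^ q` tends to `1` as `t → 1`, which later passes the energy to a strong limit. -/
lemma norm_rpow_le_combo (hq : 1 < q) {t : ℝ} (ht : 0 < t) (ht1 : t < 1) (a b : E) :
    ‖a‖ ^ q ≤ t * (1 / t) ^ q * ‖b‖ ^ q + (1 - t) * (1 / (1 - t)) ^ q * ‖a - b‖ ^ q := by
  have ht' : 0 < 1 - t := by linarith
  have h1 : ‖a‖ ≤ t * (1 / t * ‖b‖) + (1 - t) * (1 / (1 - t) * ‖a - b‖) := by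
    have := norm_add_le b (a - b)
    rw [add_sub_cancel] at this
    field_simp
    linarith
  have h2 := (convexOn_rpow hq.le).2 (x := 1 / t * ‖b‖) (y := 1 / (1 - t) * ‖a - b‖)
    (Set.mem_Ici.mpr (by positivity)) (Set.mem_Ici.mpr (by positivity)) ht.le ht'.le (by ring)
  simp only [smul_eq_mul] at h2
  have h3 := (Real.rpow_le_rpow (norm_nonneg _) h1 (by linarith)).trans h2
  rw [Real.mul_rpow (by positivity) (by positivity),
    Real.mul_rpow (by positivity) (by positivity)] at h3
  linarith

variable [NormedSpace ℝ E]

/-- The convexity defect of `‖·‖ ^ q` at the midpoint of `a` and `b`. -/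
noncomputable def rpowDefect (q : ℝ) (a b : E) : ℝ :=
  (‖a‖ ^ q + ‖b‖ ^ q) / 2 - ‖(1 / 2 : ℝ) • (a + b)‖ ^ q

lemma continuous_rpowDefect (hq : 0 < q) :
    Continuous fun z : E × E => rpowDefect q z.1 z.2 := by
  have h := continuous_norm_rpow_of_pos (E := E) hq
  unfold rpowDefect
  exact (((h.comp continuous_fst).add (h.comp continuous_snd)).div_const 2).sub
    (h.comp ((continuous_fst.add continuous_snd).const_smul (1 / 2 : ℝ)))

lemma norm_midpoint_le (a b : E) : ‖(1 / 2 : ℝ) • (a + b)‖ ≤ (1 / 2) * ‖a‖ + (1 / 2) * ‖b‖ := by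
  rw [norm_smul, Real.norm_of_nonneg (by norm_num), ← mul_add]
  gcongr
  exact norm_add_le a b

lemma rpowDefect_nonneg (hq : 1 < q) (a b : E) : 0 ≤ rpowDefect q a b := by
  have h1 := Real.rpow_le_rpow (norm_nonneg _) (norm_midpoint_le a b) (by linarith : 0 ≤ q)
  have h2 := (convexOn_rpow hq.le).2 (norm_nonneg a) (norm_nonneg b)
    (by norm_num : (0 : ℝ) ≤ 1 / 2) (by norm_num : (0 : ℝ) ≤ 1 / 2) (by norm_num)
  simp only [smul_eq_mul] at h2
  unfold rpowDefect
  linarith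

/-- If the norms agree, strict convexity of the ball makes the midpoint shorter; if they differ,
strict convexity of `r ^ q` on the half line gives the gap. -/
lemma rpowDefect_pos [StrictConvexSpace ℝ E] (hq : 1 < q) {a b : E} (hab : a ≠ b) :
    0 < rpowDefect q a b := by
  unfold rpowDefect
  by_cases hn : ‖a‖ = ‖b‖
  · have h0 : ‖(1 / 2 : ℝ) • (a + b)‖ < ‖b‖ := by
      have := norm_combo_lt_of_ne (r := ‖b‖) hn.le le_rfl hab
        (by norm_num : (0 : ℝ) < 1 / 2) (by norm_num : (0 : ℝ) < 1 / 2) (by norm_num)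
      rwa [← smul_add] at this
    have := Real.rpow_lt_rpow (norm_nonneg _) h0 (by linarith : 0 < q)
    rw [hn]
    linarith
  · have h1 := Real.rpow_le_rpow (norm_nonneg _) (norm_midpoint_le a b) (by linarith : 0 ≤ q)
    have h2 := (strictConvexOn_rpow hq).2 (norm_nonneg a) (norm_nonneg b) hn
      (by norm_num : (0 : ℝ) < 1 / 2) (by norm_num : (0 : ℝ) < 1 / 2) (by norm_num)
    simp only [smul_eq_mul] at h2
    linarith

lemma norm_smul_rpow {r : ℝ} (h : 0 ≤ r) (a : E) :
    ‖r • a‖ ^ q = r ^ q * ‖a‖ ^ q := by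
  rw [norm_smul, Real.norm_of_nonneg h, Real.mul_rpow h (norm_nonneg a)]

/-- Quantitative strict convexity of `‖·‖ ^ q` on a finite dimensional strictly convex space. -/
lemma exists_norm_sub_rpow_le [StrictConvexSpace ℝ E] [ProperSpace E] (hq : 1 < q) {ε : ℝ}
    (hε : 0 < ε) : ∃ K : ℝ, 0 ≤ K ∧ ∀ a b : E,
      ‖a - b‖ ^ q ≤ ε * (‖a‖ ^ q + ‖b‖ ^ q) + K * rpowDefect q a b := by
  have hq0 : 0 < q := by linarith
  have hc := continuous_norm_rpow_of_pos (E := E) hq0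
  -- Normalized pairs that are not close: a compact set avoiding the diagonal, on which the defect
  -- has a positive minimum `d`. There `‖a - b‖ ≤ 2`, hence the constant `2 ^ q / d`.
  set S : Set (E × E) := {z | ‖z.1‖ ^ q + ‖z.2‖ ^ q = 1 ∧ ε ≤ ‖z.1 - z.2‖ ^ q} with hS
  have hle1 : ∀ {r : ℝ}, 0 ≤ r → r ^ q ≤ 1 → r ≤ 1 := by
    intro r hr h
    by_contra! h'
    exact absurd h (not_le.mpr (Real.one_lt_rpow h' hq0))
  have hScomp : IsCompact S := by
    apply (isCompact_closedBall (0 : E × E) 1).of_isClosed_subset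
    · exact (isClosed_eq ((hc.comp continuous_fst).add (hc.comp continuous_snd))
        continuous_const).inter (isClosed_le continuous_const
          (hc.comp (continuous_fst.sub continuous_snd)))
    · rintro ⟨a, b⟩ ⟨h, -⟩
      have ha : 0 ≤ ‖a‖ ^ q := by positivity
      have hb : 0 ≤ ‖b‖ ^ q := by positivity
      simp only at h
      simp only [mem_closedBall_zero_iff, Prod.norm_def, sup_le_iff]
      exact ⟨hle1 (norm_nonneg a) (by linarith), hle1 (norm_nonneg b) (by linarith)⟩
  obtain ⟨d, hd, hdS⟩ : ∃ d : ℝ, 0 < d ∧ ∀ z ∈ S, d ≤ rpowDefect q z.1 z.2 := by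
    rcases S.eq_empty_or_nonempty with he | hne
    · exact ⟨1, one_pos, by simp [he]⟩
    · obtain ⟨z, hz, hmin⟩ := hScomp.exists_isMinOn hne (continuous_rpowDefect hq0).continuousOn
      refine ⟨_, rpowDefect_pos hq ?_, fun w hw => hmin hw⟩
      intro h
      have := hz.2
      rw [h, sub_self, norm_zero, Real.zero_rpow hq0.ne'] at this
      linarith
  refine ⟨2 ^ q / d, by positivity, ?_⟩
  have unit : ∀ a b : E, ‖a‖ ^ q + ‖b‖ ^ q = 1 →
      ‖a - b‖ ^ q ≤ ε + 2 ^ q / d * rpowDefect q a b := by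
    intro a b h
    have hD := rpowDefect_nonneg hq a b
    rcases le_total (‖a - b‖ ^ q) ε with h1 | h1
    · have : 0 ≤ 2 ^ q / d * rpowDefect q a b := by positivity
      linarith
    · have h2 := hdS (a, b) ⟨h, h1⟩
      have ha : 0 ≤ ‖a‖ ^ q := by positivity
      have hb : 0 ≤ ‖b‖ ^ q := by positivity
      have h3 : ‖a - b‖ ≤ 2 := by
        have := norm_sub_le a b
        linarith [hle1 (norm_nonneg a) (by linarith), hle1 (norm_nonneg b) (by linarith)]
      have h4 := Real.rpow_le_rpow (norm_nonneg _) h3 hq0.le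
      have h5 : (2 : ℝ) ^ q ≤ 2 ^ q / d * rpowDefect q a b := by
        rw [div_mul_eq_mul_div, le_div_iff₀ hd]
        gcongr
      linarith
  intro a b
  set s := ‖a‖ ^ q + ‖b‖ ^ q with hs
  have ha : 0 ≤ ‖a‖ ^ q := by positivity
  have hb : 0 ≤ ‖b‖ ^ q := by positivity
  rcases (by positivity : 0 ≤ s).eq_or_lt with h0 | hpos
  · have ha' : a = 0 := by
      have : ‖a‖ ^ q = 0 := by linarith
      simpa using (Real.rpow_eq_zero (norm_nonneg a) hq0.ne').mp this
    have hb' : b = 0 := by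
      have : ‖b‖ ^ q = 0 := by linarith
      simpa using (Real.rpow_eq_zero (norm_nonneg b) hq0.ne').mp this
    rw [← h0, ha', hb']
    simp [rpowDefect, Real.zero_rpow hq0.ne']
  -- All terms are homogeneous of degree `q`; scaling by `s ^ (-1/q)` reduces to the normalized
  -- case.
  · set r : ℝ := s ^ (-(1 / q)) with hr
    have hr0 : 0 ≤ r := by positivity
    have hrq : r ^ q = s⁻¹ := by
      rw [hr, ← Real.rpow_mul hpos.le, neg_mul, one_div, inv_mul_cancel₀ hq0.ne',
        Real.rpow_neg_one]
    have key := unit (r • a) (r • b) (by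
      rw [norm_smul_rpow hr0, norm_smul_rpow hr0, hrq, ← mul_add, ← hs,
        inv_mul_cancel₀ hpos.ne'])
    have hD : rpowDefect q (r • a) (r • b) = s⁻¹ * rpowDefect q a b := by
      unfold rpowDefect
      rw [← smul_add, smul_comm, norm_smul_rpow hr0, norm_smul_rpow hr0,
        norm_smul_rpow hr0 ((1 / 2 : ℝ) • (a + b)), hrq]
      ring
    rw [← smul_sub, norm_smul_rpow hr0, hrq, hD, inv_mul_le_iff₀ hpos] at key
    calc _ ≤ _ := key
      _ = _ := by field_simp

/-- Young's inequality with exponents `q / (q - 1)` and `q`, cleared of denominators. -/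
lemma rpow_sub_one_mul_le (hq : 1 < q) {r s : ℝ} (hr : 0 ≤ r) (hs : 0 ≤ s) :
    q * (r ^ (q - 1) * s) ≤ s ^ q + (q - 1) * r ^ q := by
  have hc : (q / (q - 1)).HolderConjugate q := (Real.HolderConjugate.conjExponent hq).symm
  have h := Real.young_inequality_of_nonneg (by positivity : 0 ≤ r ^ (q - 1)) hs hc
  have hq1 : 0 < q - 1 := by linarith
  rw [← Real.rpow_mul hr, mul_div_cancel₀ _ hq1.ne'] at h
  have := mul_le_mul_of_nonneg_left h (by linarith : 0 ≤ q)
  calc _ ≤ _ := this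
    _ = _ := by field_simp; ring

end Pointwise

/-! ### The tangent inequality and the vector field `‖a‖ ^ (q - 2) • a`. -/

section Inner

variable {𝕜 : Type*} [RCLike 𝕜] {E : Type*} [NormedAddCommGroup E] [InnerProductSpace 𝕜 E] {q : ℝ}

/-- A convex function lies above its tangents. Cauchy-Schwarz reduces this to norms, where it is
Young's inequality. -/
lemma norm_rpow_gradient_le (hq : 1 < q) (a b : E) :
    ‖a‖ ^ q + q * (‖a‖ ^ (q - 2) * RCLike.re (inner 𝕜 (b - a) a)) ≤ ‖b‖ ^ q := by
  have h1 : RCLike.re (inner 𝕜 (b - a) a) ≤ ‖b‖ * ‖a‖ - ‖a‖ ^ 2 := by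
    rw [inner_sub_left, map_sub, inner_self_eq_norm_sq]
    linarith [re_inner_le_norm (𝕜 := 𝕜) b a]
  have h2 : q * (‖a‖ ^ (q - 2) * RCLike.re (inner 𝕜 (b - a) a)) ≤
      q * (‖a‖ ^ (q - 2) * (‖b‖ * ‖a‖ - ‖a‖ ^ 2)) := by gcongr
  have h3 := rpow_sub_one_mul_le hq (norm_nonneg a) (norm_nonneg b)
  rcases eq_or_ne a 0 with rfl | ha
  · simp [Real.zero_rpow (by linarith : q ≠ 0)]
    positivity
  · have hpos : 0 < ‖a‖ := norm_pos_iff.mpr ha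
    have e1 : ‖a‖ ^ (q - 1) = ‖a‖ ^ (q - 2) * ‖a‖ := by
      rw [← Real.rpow_add_one hpos.ne']; ring_nf
    have e2 : ‖a‖ ^ q = ‖a‖ ^ (q - 2) * ‖a‖ ^ 2 := by
      rw [← Real.rpow_natCast, ← Real.rpow_add hpos]; norm_num
    rw [e1, e2] at h3
    rw [e2]
    nlinarith

lemma rpow_sub_two_mul_self (hq : 1 < q) {r : ℝ} (hr : 0 ≤ r) :
    r ^ (q - 2) * r = r ^ (q - 1) := by
  rcases hr.eq_or_lt with rfl | h
  · rw [mul_zero, Real.zero_rpow (by linarith)]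
  · rw [← Real.rpow_add_one h.ne']; ring_nf

lemma rpow_sub_one_mul_self (hq : 1 < q) {r : ℝ} (hr : 0 ≤ r) :
    r ^ (q - 1) * r = r ^ q := by
  rcases hr.eq_or_lt with rfl | h
  · rw [mul_zero, Real.zero_rpow (by linarith)]
  · rw [← Real.rpow_add_one h.ne']; ring_nf

/-- Only `a = 0` is delicate, since the power is singular there for `q < 2`. Cauchy-Schwarz bounds
the product by `‖a‖ ^ (q - 1) * ‖b‖`, which tends to `0` because `q > 1`. -/
lemma continuous_norm_rpow_mul_re_inner (hq : 1 < q) (b : E) :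
    Continuous fun a : E => ‖a‖ ^ (q - 2) * RCLike.re (inner 𝕜 b a) := by
  rw [continuous_iff_continuousAt]
  intro a
  rcases eq_or_ne a 0 with rfl | ha
  · have hlim : Filter.Tendsto (fun a : E => ‖a‖ ^ (q - 1) * ‖b‖) (nhds 0) (nhds 0) := by
      have : Continuous fun a : E => ‖a‖ ^ (q - 1) * ‖b‖ :=
        (continuous_norm.rpow_const fun _ => Or.inr (by linarith)).mul_const _
      simpa [Real.zero_rpow (by linarith : q - 1 ≠ 0)] using this.tendsto 0
    have h0 : ‖(0 : E)‖ ^ (q - 2) * RCLike.re (inner 𝕜 b 0) = 0 := by simp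
    rw [ContinuousAt, h0]
    refine squeeze_zero_norm (fun a => ?_) hlim
    rw [norm_mul, Real.norm_of_nonneg (by positivity : 0 ≤ ‖a‖ ^ (q - 2)),
      ← rpow_sub_two_mul_self hq (norm_nonneg a), mul_assoc]
    gcongr
    rw [Real.norm_eq_abs, mul_comm]
    exact (RCLike.abs_re_le_norm _).trans (norm_inner_le_norm b a)
  · exact (continuous_norm.continuousAt.rpow_const (Or.inl (norm_ne_zero_iff.mpr ha))).mul
      (RCLike.continuous_re.comp (continuous_const.inner continuous_id)).continuousAt

end Inner

/-! ### Minimization of the weighted energy over closed midpoint-convex sets in `L^p`. -/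

section Weighted

open Filter Topology

variable {α : Type*} [MeasurableSpace α] {μ : Measure α} {E : Type*} [NormedAddCommGroup E]
  {p : ℝ≥0∞} {γ : α → ℝ} {c M : ℝ}

/-- The weighted energy `∫ γ ‖a‖ ^ q`. -/
noncomputable def weightedEnergy (μ : Measure α) (γ : α → ℝ) (q : ℝ) (a : α → E) : ℝ :=
  ∫ x, γ x * ‖a x‖ ^ q ∂μ

/-- The weight `γ` is measurable with `c ≤ γ ≤ M` almost everywhere, where `0 < c`. -/
structure IsBddWeight (μ : Measure α) (γ : α → ℝ) (c M : ℝ) : Prop where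
  meas : AEStronglyMeasurable γ μ
  pos : 0 < c
  lower : ∀ᵐ x ∂μ, c ≤ γ x
  upper : ∀ᵐ x ∂μ, γ x ≤ M

lemma IsBddWeight.norm_le (hw : IsBddWeight μ γ c M) : ∀ᵐ x ∂μ, ‖γ x‖ ≤ M := by
  filter_upwards [hw.lower, hw.upper] with x h1 h2
  rwa [Real.norm_of_nonneg (hw.pos.le.trans h1)]

lemma IsBddWeight.integrable_mul (hw : IsBddWeight μ γ c M) {h : α → ℝ} (hh : Integrable h μ) :
    Integrable (fun x => γ x * h x) μ :=
  hh.bdd_mul hw.meas hw.norm_le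

lemma integrable_norm_rpow_toReal (hp₁ : 1 < p) (hp₂ : p < ⊤) {a : α → E} (ha : MemLp a p μ) :
    Integrable (fun x => ‖a x‖ ^ p.toReal) μ :=
  ha.integrable_norm_rpow (zero_lt_one.trans hp₁).ne' hp₂.ne

lemma one_lt_toReal (hp₁ : 1 < p) (hp₂ : p < ⊤) : 1 < p.toReal := by
  simpa using (ENNReal.toReal_lt_toReal ENNReal.one_ne_top hp₂.ne).mpr hp₁

lemma Lp_norm_rpow_eq_integral (hp₁ : 1 < p) (hp₂ : p < ⊤) (a : Lp E p μ) :
    ‖a‖ ^ p.toReal = ∫ x, ‖a x‖ ^ p.toReal ∂μ := by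
  have hq := one_lt_toReal hp₁ hp₂
  have h0 : 0 ≤ ∫ x, ‖a x‖ ^ p.toReal ∂μ := integral_nonneg fun x => by positivity
  rw [Lp.norm_def, (Lp.memLp a).eLpNorm_eq_integral_rpow_norm (zero_lt_one.trans hp₁).ne' hp₂.ne,
    ENNReal.toReal_ofReal (by positivity), ← Real.rpow_mul h0,
    inv_mul_cancel₀ (by linarith), Real.rpow_one]

lemma weightedEnergy_congr {q : ℝ} {a b : α → E} (h : a =ᵐ[μ] b) :
    weightedEnergy μ γ q a = weightedEnergy μ γ q b :=
  integral_congr_ae (h.mono fun x hx => by simp only [hx])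

lemma weightedEnergy_nonneg (hw : IsBddWeight μ γ c M) (q : ℝ) (a : α → E) :
    0 ≤ weightedEnergy μ γ q a := by
  apply integral_nonneg_of_ae
  filter_upwards [hw.lower] with x hx
  have := hw.pos.le.trans hx
  simp only [Pi.zero_apply]
  positivity

lemma weightedEnergy_integrable (hw : IsBddWeight μ γ c M) (hp₁ : 1 < p) (hp₂ : p < ⊤)
    {a : α → E} (ha : MemLp a p μ) : Integrable (fun x => γ x * ‖a x‖ ^ p.toReal) μ :=
  hw.integrable_mul (integrable_norm_rpow_toReal hp₁ hp₂ ha)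

lemma mul_norm_rpow_le_weightedEnergy (hw : IsBddWeight μ γ c M) (hp₁ : 1 < p) (hp₂ : p < ⊤)
    (a : Lp E p μ) : c * ‖a‖ ^ p.toReal ≤ weightedEnergy μ γ p.toReal a := by
  rw [Lp_norm_rpow_eq_integral hp₁ hp₂, ← integral_const_mul]
  apply integral_mono_ae ((integrable_norm_rpow_toReal hp₁ hp₂ (Lp.memLp a)).const_mul c)
    (weightedEnergy_integrable hw hp₁ hp₂ (Lp.memLp a))
  filter_upwards [hw.lower] with x hx
  gcongr

lemma weightedEnergy_le_mul_norm_rpow (hw : IsBddWeight μ γ c M) (hp₁ : 1 < p) (hp₂ : p < ⊤)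
    (a : Lp E p μ) : weightedEnergy μ γ p.toReal a ≤ M * ‖a‖ ^ p.toReal := by
  rw [Lp_norm_rpow_eq_integral hp₁ hp₂, ← integral_const_mul]
  apply integral_mono_ae (weightedEnergy_integrable hw hp₁ hp₂ (Lp.memLp a))
    ((integrable_norm_rpow_toReal hp₁ hp₂ (Lp.memLp a)).const_mul M)
  filter_upwards [hw.upper] with x hx
  gcongr

lemma weightedEnergy_le_combo (hw : IsBddWeight μ γ c M) (hp₁ : 1 < p) (hp₂ : p < ⊤)
    {t : ℝ} (ht : 0 < t) (ht1 : t < 1) (a b : Lp E p μ) :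
    weightedEnergy μ γ p.toReal a ≤ t * (1 / t) ^ p.toReal * weightedEnergy μ γ p.toReal b +
      (1 - t) * (1 / (1 - t)) ^ p.toReal * (M * ‖a - b‖ ^ p.toReal) := by
  have hq := one_lt_toReal hp₁ hp₂
  have ht' : 0 < 1 - t := by linarith
  have h1 : weightedEnergy μ γ p.toReal a ≤
      t * (1 / t) ^ p.toReal * weightedEnergy μ γ p.toReal b +
        (1 - t) * (1 / (1 - t)) ^ p.toReal * weightedEnergy μ γ p.toReal (a - b : Lp E p μ) := by
    unfold weightedEnergy
    have ib := weightedEnergy_integrable hw hp₁ hp₂ (Lp.memLp b)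
    have iab := weightedEnergy_integrable hw hp₁ hp₂ (Lp.memLp (a - b))
    rw [← integral_const_mul, ← integral_const_mul,
      ← integral_add (ib.const_mul _) (iab.const_mul _)]
    apply integral_mono_ae (weightedEnergy_integrable hw hp₁ hp₂ (Lp.memLp a))
      ((ib.const_mul _).add (iab.const_mul _))
    filter_upwards [hw.lower, Lp.coeFn_sub a b] with x hx hs
    have hγ := hw.pos.le.trans hx
    have := mul_le_mul_of_nonneg_left (norm_rpow_le_combo hq ht ht1 (a x) (b x)) hγ
    simp only [Pi.add_apply, hs, Pi.sub_apply]
    linarith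
  have h2 := weightedEnergy_le_mul_norm_rpow hw hp₁ hp₂ (a - b)
  have : 0 ≤ (1 - t) * (1 / (1 - t)) ^ p.toReal := by positivity
  nlinarith [mul_le_mul_of_nonneg_left h2 this]

variable [NormedSpace ℝ E] [StrictConvexSpace ℝ E] [ProperSpace E]

/-- Uniform convexity of the weighted energy. -/
lemma exists_norm_sub_le_weightedEnergy (hw : IsBddWeight μ γ c M) (hp₁ : 1 < p) (hp₂ : p < ⊤)
    {ε : ℝ} (hε : 0 < ε) : ∃ K : ℝ, 0 ≤ K ∧ ∀ a b : Lp E p μ,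
      c * ‖a - b‖ ^ p.toReal ≤
        ε * (weightedEnergy μ γ p.toReal a + weightedEnergy μ γ p.toReal b) +
        K * ((weightedEnergy μ γ p.toReal a + weightedEnergy μ γ p.toReal b) / 2 -
          weightedEnergy μ γ p.toReal ((1 / 2 : ℝ) • (a + b) : Lp E p μ)) := by
  obtain ⟨K, hK, h⟩ := exists_norm_sub_rpow_le (E := E) (one_lt_toReal hp₁ hp₂) hε
  refine ⟨K, hK, fun a b => (mul_norm_rpow_le_weightedEnergy hw hp₁ hp₂ (a - b)).trans ?_⟩
  have ia := weightedEnergy_integrable hw hp₁ hp₂ (Lp.memLp a)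
  have ib := weightedEnergy_integrable hw hp₁ hp₂ (Lp.memLp b)
  have iab := weightedEnergy_integrable hw hp₁ hp₂ (Lp.memLp (a - b))
  have im := weightedEnergy_integrable hw hp₁ hp₂ (Lp.memLp ((1 / 2 : ℝ) • (a + b)))
  have is : Integrable (fun x => γ x * ‖a x‖ ^ p.toReal + γ x * ‖b x‖ ^ p.toReal) μ := ia.add ib
  have id : Integrable (fun x => (γ x * ‖a x‖ ^ p.toReal + γ x * ‖b x‖ ^ p.toReal) / 2 -
    γ x * ‖((1 / 2 : ℝ) • (a + b) : Lp E p μ) x‖ ^ p.toReal) μ := (is.div_const 2).sub im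
  unfold weightedEnergy
  rw [← integral_add ia ib, ← integral_div, ← integral_sub (is.div_const 2) im,
    ← integral_const_mul, ← integral_const_mul, ← integral_add (is.const_mul _) (id.const_mul _)]
  apply integral_mono_ae iab ((is.const_mul _).add (id.const_mul _))
  filter_upwards [hw.lower, Lp.coeFn_sub a b, Lp.coeFn_add a b,
    Lp.coeFn_smul (1 / 2 : ℝ) (a + b)] with x hx h1 h2 h3
  have hγ := hw.pos.le.trans hx
  have := mul_le_mul_of_nonneg_left (h (a x) (b x)) hγ
  simp only [rpowDefect] at this
  simp only [h1, h3, Pi.sub_apply, Pi.smul_apply, h2, Pi.add_apply]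
  linarith

variable [Fact (1 ≤ p)]

/-- The midpoint of two minimizers is a competitor, so their convexity defect is at most `0`;
uniform convexity with arbitrarily small `ε` then forces the distance to vanish. -/
lemma eq_of_weightedEnergy_minimal (hw : IsBddWeight μ γ c M) (hp₁ : 1 < p) (hp₂ : p < ⊤)
    {A : Set (Lp E p μ)} (hmid : ∀ a ∈ A, ∀ b ∈ A, (1 / 2 : ℝ) • (a + b) ∈ A)
    {a b : Lp E p μ} (ha : a ∈ A) (hb : b ∈ A)
    (ha' : ∀ v ∈ A, weightedEnergy μ γ p.toReal a ≤ weightedEnergy μ γ p.toReal v)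
    (hb' : ∀ v ∈ A, weightedEnergy μ γ p.toReal b ≤ weightedEnergy μ γ p.toReal v) : a = b := by
  have hq := one_lt_toReal hp₁ hp₂
  have hle : c * ‖a - b‖ ^ p.toReal ≤ 0 := by
    set S := weightedEnergy μ γ p.toReal a + weightedEnergy μ γ p.toReal b with hS
    have hS0 : 0 ≤ S := add_nonneg (weightedEnergy_nonneg hw _ _) (weightedEnergy_nonneg hw _ _)
    refine le_of_forall_pos_le_add fun δ hδ => ?_
    obtain ⟨K, hK, h⟩ := exists_norm_sub_le_weightedEnergy (E := E) hw hp₁ hp₂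
      (ε := δ / (S + 1)) (by positivity)
    have h1 := h a b
    rw [← hS] at h1
    have h2 := ha' _ (hmid a ha b hb)
    have h3 := hb' _ (hmid a ha b hb)
    have h4 : δ / (S + 1) * S ≤ δ := by
      rw [div_mul_eq_mul_div, div_le_iff₀ (by positivity)]
      nlinarith
    have h5 : K * (S / 2 -
        weightedEnergy μ γ p.toReal ((1 / 2 : ℝ) • (a + b) : Lp E p μ)) ≤ 0 :=
      mul_nonpos_of_nonneg_of_nonpos hK (by linarith)
    linarith
  have h0 : ‖a - b‖ ^ p.toReal = 0 :=
    le_antisymm (by nlinarith [hw.pos]) (by positivity)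
  rw [Real.rpow_eq_zero (norm_nonneg _) (by linarith), norm_eq_zero, sub_eq_zero] at h0
  exact h0

/-- Midpoints of a minimizing sequence stay in `A`, so their energy is at least the infimum and the
defects tend to `0`. Uniform convexity then makes the sequence Cauchy in norm. -/
lemma exists_weightedEnergy_minimal [CompleteSpace E] (hw : IsBddWeight μ γ c M)
    (hp₁ : 1 < p) (hp₂ : p < ⊤) {A : Set (Lp E p μ)} (hne : A.Nonempty) (hcl : IsClosed A)
    (hmid : ∀ a ∈ A, ∀ b ∈ A, (1 / 2 : ℝ) • (a + b) ∈ A) :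
    ∃ a ∈ A, ∀ v ∈ A, weightedEnergy μ γ p.toReal a ≤ weightedEnergy μ γ p.toReal v := by
  have hq := one_lt_toReal hp₁ hp₂
  have hq0 : 0 < p.toReal := by linarith
  set N : Lp E p μ → ℝ := fun a => weightedEnergy μ γ p.toReal a with hN
  have hN0 : ∀ a, 0 ≤ N a := fun a => weightedEnergy_nonneg hw _ _
  set m := sInf (N '' A) with hm
  have hbdd : BddBelow (N '' A) := ⟨0, by rintro _ ⟨a, -, rfl⟩; exact hN0 a⟩
  have hmle : ∀ a ∈ A, m ≤ N a := fun a ha => csInf_le hbdd ⟨a, ha, rfl⟩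
  have hm0 : 0 ≤ m := le_csInf (hne.image N) (by rintro _ ⟨a, -, rfl⟩; exact hN0 a)
  have hex : ∀ k : ℕ, ∃ a ∈ A, N a < m + 1 / ((k : ℝ) + 1) := by
    intro k
    obtain ⟨_, ⟨a, ha, rfl⟩, h⟩ := exists_lt_of_csInf_lt (hne.image N)
      (show sInf (N '' A) < m + 1 / ((k : ℝ) + 1) by
        rw [← hm]; linarith [Nat.one_div_pos_of_nat (α := ℝ) (n := k)])
    exact ⟨a, ha, h⟩
  choose u huA hu using hex
  have hcau : CauchySeq u := by
    rw [Metric.cauchySeq_iff]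
    intro δ hδ
    have hη : 0 < c * δ ^ p.toReal := mul_pos hw.pos (by positivity)
    -- Two late energies add up to at most `2 * (m + 1)`, so this `ε` costs at most half of `c * δ ^
    -- q`; `N₀` then makes the defect term smaller than the other half. Using `m + 1` covers `m =
    -- 0`.
    obtain ⟨K, hK, h⟩ := exists_norm_sub_le_weightedEnergy (E := E) hw hp₁ hp₂
      (ε := c * δ ^ p.toReal / (4 * (m + 1))) (by positivity)
    obtain ⟨N₀, hN₀⟩ := exists_nat_gt (2 * K / (c * δ ^ p.toReal))
    refine ⟨N₀, fun k hk l hl => ?_⟩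
    have hb : ∀ j, N₀ ≤ j → N (u j) ≤ m + 1 / ((N₀ : ℝ) + 1) := fun j hj =>
      (hu j).le.trans (by gcongr)
    have h1 := hb k hk
    have h2 := hb l hl
    have h3 := hmle _ (hmid _ (huA k) _ (huA l))
    have h4 : c * ‖u k - u l‖ ^ p.toReal ≤ c * δ ^ p.toReal / (4 * (m + 1)) *
        (N (u k) + N (u l)) + K * ((N (u k) + N (u l)) / 2 - N ((1 / 2 : ℝ) • (u k + u l))) :=
      h (u k) (u l)
    have h5 : 1 / ((N₀ : ℝ) + 1) ≤ 1 := by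
      rw [div_le_one (by positivity)]
      linarith [Nat.cast_nonneg (α := ℝ) N₀]
    have h6 : c * δ ^ p.toReal / (4 * (m + 1)) * (N (u k) + N (u l)) ≤
        c * δ ^ p.toReal / (4 * (m + 1)) * (2 * (m + 1)) := by
      gcongr
      linarith
    have h7 : c * δ ^ p.toReal / (4 * (m + 1)) * (2 * (m + 1)) = c * δ ^ p.toReal / 2 := by
      field_simp
      norm_num
    have h8 : K * ((N (u k) + N (u l)) / 2 - N ((1 / 2 : ℝ) • (u k + u l))) ≤
        K * (1 / ((N₀ : ℝ) + 1)) := by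
      gcongr
      linarith
    have h9 : K * (1 / ((N₀ : ℝ) + 1)) < c * δ ^ p.toReal / 2 := by
      rw [mul_one_div, div_lt_iff₀ (by positivity)]
      rw [div_lt_iff₀ hη] at hN₀
      nlinarith
    have h10 : ‖u k - u l‖ ^ p.toReal < δ ^ p.toReal := by
      have : c * ‖u k - u l‖ ^ p.toReal < c * δ ^ p.toReal := by linarith
      exact lt_of_mul_lt_mul_left this hw.pos.le
    rw [dist_eq_norm]
    exact (Real.rpow_lt_rpow_iff (norm_nonneg _) hδ.le hq0).mp h10
  obtain ⟨a, hlim⟩ := cauchySeq_tendsto_of_complete hcau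
  have haA : a ∈ A := hcl.mem_of_tendsto hlim (Eventually.of_forall huA)
  refine ⟨a, haA, fun v hv => le_trans ?_ (hmle v hv)⟩
  have hNu : Tendsto (fun k => N (u k)) atTop (𝓝 m) := by
    refine tendsto_of_tendsto_of_tendsto_of_le_of_le tendsto_const_nhds
      (h := fun k : ℕ => m + 1 / ((k : ℝ) + 1)) ?_ (fun k => hmle _ (huA k)) fun k => (hu k).le
    simpa using tendsto_const_nhds.add (tendsto_one_div_add_atTop_nhds_zero_nat (𝕜 := ℝ))
  have hdist : Tendsto (fun k => ‖a - u k‖ ^ p.toReal) atTop (𝓝 0) := by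
    have h1 : Tendsto (fun k => ‖a - u k‖) atTop (𝓝 0) := by
      simpa using (tendsto_const_nhds.sub hlim : Tendsto (fun k => a - u k) atTop (𝓝 (a - a))).norm
    simpa [Real.zero_rpow hq0.ne'] using h1.rpow_const (Or.inr hq0.le)
  -- The limit `k → ∞` is taken with `t` fixed, since the coefficient of the error term blows up as
  -- `t → 1`. Only afterwards does `t` tend to `1`.
  have ht : ∀ t : ℝ, 0 < t → t < 1 → N a ≤ t * (1 / t) ^ p.toReal * m := by
    intro t ht ht1
    have := (hNu.const_mul (t * (1 / t) ^ p.toReal)).add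
      ((hdist.const_mul M).const_mul ((1 - t) * (1 / (1 - t)) ^ p.toReal))
    rw [mul_zero, mul_zero, add_zero] at this
    exact ge_of_tendsto' this fun k => weightedEnergy_le_combo hw hp₁ hp₂ ht ht1 a (u k)
  have hlim1 : Tendsto (fun t : ℝ => t * (1 / t) ^ p.toReal * m) (𝓝[<] 1) (𝓝 m) := by
    have hcont : ContinuousAt (fun t : ℝ => t * (1 / t) ^ p.toReal * m) 1 :=
      (continuousAt_id.mul ((continuousAt_const.div continuousAt_id one_ne_zero).rpow_const
        (Or.inr hq0.le))).mul continuousAt_const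
    simpa using hcont.tendsto.mono_left nhdsWithin_le_nhds
  refine ge_of_tendsto hlim1 ?_
  filter_upwards [Ioo_mem_nhdsLT (zero_lt_one' ℝ)] with t h
  exact ht t h.1 h.2

end Weighted

/-! ### Completeness of the Sobolev spaces. -/

section SobolevComplete

open Filter Topology

variable {𝕜 : Type*} [RCLike 𝕜] {n : ℕ} {Ω : Set (EuclideanSpace ℝ (Fin n))} {p : ℝ≥0∞}
  [Fact (1 ≤ p)]

lemma volume_restrict_univ_lt_top (hΩb : Bornology.IsBounded Ω) :
    (volume.restrict Ω) Set.univ < ⊤ := by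
  rw [Measure.restrict_apply_univ]
  exact hΩb.measure_lt_top

/-- On a finite measure space `L^p` embeds continuously in `L^1`, where integration against a
bounded function is continuous. -/
lemma continuous_integral_smul_Lp {α F : Type*} [MeasurableSpace α] {μ : Measure α}
    [IsFiniteMeasure μ] [NormedAddCommGroup F] [NormedSpace ℝ F] {ψ : α → ℝ}
    (hψ : AEStronglyMeasurable ψ μ) {B : ℝ} (hB : ∀ x, ‖ψ x‖ ≤ B) :
    Continuous fun u : Lp F p μ => ∫ x, ψ x • u x ∂μ := by
  have hint : ∀ u : Lp F p μ, Integrable (fun x => ψ x • u x) μ := fun u =>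
    ((Lp.memLp u).integrable Fact.out).bdd_smul B hψ (ae_of_all _ hB)
  rw [continuous_iff_continuousAt]
  intro v
  refine tendsto_integral_of_L1' _ (hint v).aestronglyMeasurable (Eventually.of_forall hint) ?_
  have hlim : Tendsto (fun u : Lp F p μ => eLpNorm (⇑u - ⇑v) p μ) (𝓝 v) (𝓝 0) :=
    (Lp.tendsto_Lp_iff_tendsto_eLpNorm' (fun u : Lp F p μ => u) v).mp tendsto_id
  -- The Hölder constant of the embedding of `L^p` in `L^1`; it is finite because its exponent `1 -
  -- 1/p` is nonnegative.
  set D : ℝ≥0∞ := μ Set.univ ^ (1 / (1 : ℝ≥0∞).toReal - 1 / p.toReal) with hD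
  have hDtop : D ≠ ⊤ := by
    have h1 : (1 : ℝ) / p.toReal ≤ 1 := by
      rcases eq_or_ne p ⊤ with rfl | hp
      · simp
      · have : 1 ≤ p.toReal := by
          simpa using (ENNReal.toReal_le_toReal ENNReal.one_ne_top hp).mpr Fact.out
        rw [div_le_one (by linarith)]
        exact this
    exact ENNReal.rpow_ne_top_of_nonneg (sub_nonneg.mpr (by simpa using h1)) (measure_ne_top μ _)
  have hlim2 : Tendsto (fun u : Lp F p μ => ENNReal.ofReal B * (eLpNorm (⇑u - ⇑v) p μ * D))
      (𝓝 v) (𝓝 0) := by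
    have h1 := ENNReal.Tendsto.mul_const hlim (Or.inr hDtop)
    have h2 := ENNReal.Tendsto.const_mul h1 (Or.inr (ENNReal.ofReal_ne_top (r := B)))
    simpa using h2
  refine tendsto_of_tendsto_of_tendsto_of_le_of_le tendsto_const_nhds hlim2
    (fun _ => zero_le) fun u => ?_
  have hm : AEStronglyMeasurable (⇑u - ⇑v) μ :=
    (Lp.aestronglyMeasurable u).sub (Lp.aestronglyMeasurable v)
  calc _ ≤ ENNReal.ofReal B * eLpNorm (⇑u - ⇑v) 1 μ := by
        refine eLpNorm_le_mul_eLpNorm_of_ae_le_mul (ae_of_all _ fun x => ?_) 1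
        simp only [Pi.sub_apply]
        rw [← smul_sub, norm_smul]
        gcongr
        exact hB x
    _ ≤ _ := by
        gcongr
        exact eLpNorm_le_eLpNorm_mul_rpow_measure_univ Fact.out hm

lemma continuous_integral_smul_Lp_of_hasCompactSupport {F : Type*} [NormedAddCommGroup F]
    [NormedSpace ℝ F] (hΩb : Bornology.IsBounded Ω) {ψ : EuclideanSpace ℝ (Fin n) → ℝ}
    (hψ : Continuous ψ) (hc : HasCompactSupport ψ) :
    Continuous fun u : Lp F p (volume.restrict Ω) => ∫ x in Ω, ψ x • u x := by
  have : IsFiniteMeasure (volume.restrict Ω) := ⟨volume_restrict_univ_lt_top hΩb⟩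
  obtain ⟨B, hB⟩ := hψ.bounded_above_of_compact_support hc
  exact continuous_integral_smul_Lp hψ.aestronglyMeasurable hB

lemma continuous_fst_LpPair : Continuous fun w : LpPair 𝕜 Ω p => w.fst :=
  (WithLp.fstL p 𝕜 (Lp 𝕜 p (volume.restrict Ω))
    (Lp (EuclideanSpace 𝕜 (Fin n)) p (volume.restrict Ω))).continuous

lemma continuous_snd_LpPair : Continuous fun w : LpPair 𝕜 Ω p => w.snd :=
  (WithLp.sndL p 𝕜 (Lp 𝕜 p (volume.restrict Ω))
    (Lp (EuclideanSpace 𝕜 (Fin n)) p (volume.restrict Ω))).continuous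

/-- For each test function and index, the weak gradient identity equates two continuous functionals
of the pair, so it cuts out a closed set. -/
lemma isClosed_sobolev (hΩb : Bornology.IsBounded Ω) :
    IsClosed (Sobolev 𝕜 Ω p : Set (LpPair 𝕜 Ω p)) := by
  have hset : (Sobolev 𝕜 Ω p : Set (LpPair 𝕜 Ω p)) =
      {w | HasWeakGradient Ω (w.fst : EuclideanSpace ℝ (Fin n) → 𝕜)
        (w.snd : EuclideanSpace ℝ (Fin n) → EuclideanSpace 𝕜 (Fin n))} := rfl
  rw [hset]
  simp only [HasWeakGradient, Set.ofPred_forall]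
  refine isClosed_iInter fun φ => isClosed_iInter fun hφ => isClosed_iInter fun hc =>
    isClosed_iInter fun _ => isClosed_iInter fun i => isClosed_eq ?_ (Continuous.neg ?_)
  · exact (continuous_integral_smul_Lp_of_hasCompactSupport hΩb (continuous_partial hφ _)
      (hasCompactSupport_partial hc _)).comp (continuous_fst_LpPair (𝕜 := 𝕜) (Ω := Ω) (p := p))
  · have h1 := (continuous_integral_smul_Lp_of_hasCompactSupport (F := 𝕜) (p := p) hΩb
      hφ.continuous hc).comp
      ((((EuclideanSpace.proj i : EuclideanSpace 𝕜 (Fin n) →L[𝕜] 𝕜).compLpL p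
        (volume.restrict Ω)).continuous).comp (continuous_snd_LpPair (𝕜 := 𝕜) (Ω := Ω) (p := p)))
    refine h1.congr fun w => ?_
    apply integral_congr_ae
    filter_upwards [ContinuousLinearMap.coeFn_compLpL
      (EuclideanSpace.proj i : EuclideanSpace 𝕜 (Fin n) →L[𝕜] 𝕜) w.snd] with x hx
    simp only [Function.comp_apply, hx]
    rfl

lemma completeSpace_sobolev (hΩb : Bornology.IsBounded Ω) : CompleteSpace (Sobolev 𝕜 Ω p) :=
  (isClosed_sobolev hΩb).completeSpace_coe

lemma completeSpace_sobolev₀ (hΩb : Bornology.IsBounded Ω) : CompleteSpace (Sobolev₀ 𝕜 Ω p) :=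
  haveI := completeSpace_sobolev (𝕜 := 𝕜) (p := p) hΩb
  (smoothCompact 𝕜 Ω p).isClosed_topologicalClosure.completeSpace_coe

end SobolevComplete

/-! ### Complex conjugation, which links the bilinear pairing to the inner product. -/

section Conj

open Filter Topology

variable {𝕜 : Type*} [RCLike 𝕜] {n : ℕ} {Ω : Set (EuclideanSpace ℝ (Fin n))} {p : ℝ≥0∞}
  [Fact (1 ≤ p)]

/-- Coordinatewise complex conjugation on `𝕜ⁿ`. -/
noncomputable def conjVec (𝕜 : Type*) [RCLike 𝕜] (n : ℕ) :
    EuclideanSpace 𝕜 (Fin n) →L[ℝ] EuclideanSpace 𝕜 (Fin n) :=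
  (LinearIsometryEquiv.piLpCongrRight 2
    fun _ : Fin n => (RCLike.conjLIE : 𝕜 ≃ₗᵢ[ℝ] 𝕜)).toContinuousLinearEquiv

lemma conjVec_apply (v : EuclideanSpace 𝕜 (Fin n)) (i : Fin n) :
    conjVec 𝕜 n v i = starRingEnd 𝕜 (v i) := rfl

/-- Complex conjugation on pairs in `L^p`. -/
noncomputable def conjPair (w : LpPair 𝕜 Ω p) : LpPair 𝕜 Ω p :=
  WithLp.toLp p (((RCLike.conjCLE : 𝕜 ≃L[ℝ] 𝕜) : 𝕜 →L[ℝ] 𝕜).compLpL p (volume.restrict Ω) w.fst,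
    (conjVec 𝕜 n).compLpL p (volume.restrict Ω) w.snd)

lemma coeFn_conjPair_fst (w : LpPair 𝕜 Ω p) :
    ∀ᵐ x ∂volume.restrict Ω, (conjPair w).fst x = starRingEnd 𝕜 (w.fst x) :=
  ContinuousLinearMap.coeFn_compLpL _ w.fst

lemma coeFn_conjPair_snd (w : LpPair 𝕜 Ω p) :
    ∀ᵐ x ∂volume.restrict Ω, (conjPair w).snd x = conjVec 𝕜 n (w.snd x) :=
  ContinuousLinearMap.coeFn_compLpL _ w.snd

lemma continuous_conjPair : Continuous (conjPair : LpPair 𝕜 Ω p → LpPair 𝕜 Ω p) :=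
  (WithLp.prod_continuous_toLp p _ _).comp
    (((ContinuousLinearMap.continuous _).comp (continuous_fst_LpPair (𝕜 := 𝕜) (Ω := Ω) (p := p))).prodMk
      ((ContinuousLinearMap.continuous _).comp (continuous_snd_LpPair (𝕜 := 𝕜) (Ω := Ω) (p := p))))

lemma conj_real_smul (r : ℝ) (z : 𝕜) : r • starRingEnd 𝕜 z = starRingEnd 𝕜 (r • z) := by
  simp [RCLike.real_smul_eq_coe_mul]

/-- Complex conjugation on the Sobolev space. -/
noncomputable def conjSobolev (w : Sobolev 𝕜 Ω p) : Sobolev 𝕜 Ω p :=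
  ⟨conjPair w.1, by
    intro φ hφ hc hs i
    have h := congrArg (starRingEnd 𝕜) (w.2 φ hφ hc hs i)
    rw [map_neg, ← integral_conj, ← integral_conj] at h
    refine (integral_congr_ae ?_).trans (h.trans (congrArg Neg.neg (integral_congr_ae ?_)))
    · filter_upwards [coeFn_conjPair_fst w.1] with x hx
      rw [hx, conj_real_smul]
    · filter_upwards [coeFn_conjPair_snd w.1] with x hx
      rw [hx, conjVec_apply, conj_real_smul]⟩

lemma grad_conjSobolev (w : Sobolev 𝕜 Ω p) :
    ∀ᵐ x ∂volume.restrict Ω, grad (conjSobolev w) x = conjVec 𝕜 n (grad w x) :=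
  coeFn_conjPair_snd w.1

lemma conjSobolev_mem_sobolev₀ {w : Sobolev 𝕜 Ω p} (hw : w ∈ Sobolev₀ 𝕜 Ω p) :
    conjSobolev w ∈ Sobolev₀ 𝕜 Ω p := by
  have hcont : Continuous (conjSobolev : Sobolev 𝕜 Ω p → Sobolev 𝕜 Ω p) :=
    (continuous_conjPair.comp continuous_subtype_val).subtype_mk _
  refine map_mem_closure hcont hw ?_
  rintro a ⟨φ, h1, h2, h3, h4⟩
  refine ⟨fun x => starRingEnd 𝕜 (φ x), (RCLike.conjCLE (K := 𝕜)).contDiff.comp h1,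
    h2.comp_left (map_zero _), ?_, ?_⟩
  · exact (closure_mono (Function.support_comp_subset (map_zero _) φ)).trans h3
  · filter_upwards [coeFn_conjPair_fst a.1, h4] with x hx hx4
    exact hx.trans (congrArg _ hx4)

end Conj

/-! ### The Poincaré inequality. -/

section Poincare

variable {𝕜 : Type*} [RCLike 𝕜] {n : ℕ} {Ω : Set (EuclideanSpace ℝ (Fin n))} {p : ℝ≥0∞}

/-- Since `∂ᵢxᵢ = 1`, integration by parts gives `∫ |φ|^q = -∫ xᵢ ∂ᵢ|φ|^q`. With `|xᵢ| ≤ R` on the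
support, Young's inequality leaves a multiple of `∫ |φ|^q` that can be absorbed on the left. -/
lemma integral_norm_rpow_le_integral_norm_fderiv {q R : ℝ} (hq : 1 < q) (hR : 0 ≤ R)
    {φ : EuclideanSpace ℝ (Fin n) → 𝕜} (hφ : ContDiff ℝ 1 φ) (hc : HasCompactSupport φ)
    (hs : ∀ x ∈ tsupport φ, ‖x‖ ≤ R) (i : Fin n) :
    ∫ x, ‖φ x‖ ^ q ≤ (q * R) ^ q * ∫ x, ‖fderiv ℝ φ x (EuclideanSpace.single i 1)‖ ^ q := by
  have hq0 : 0 < q := by linarith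
  set e : EuclideanSpace ℝ (Fin n) := EuclideanSpace.single i 1 with he
  set L : EuclideanSpace ℝ (Fin n) →L[ℝ] ℝ := EuclideanSpace.proj i with hL
  have hLe : L e = 1 := by simp [hL, he]
  have hd : Differentiable ℝ φ := hφ.differentiable one_ne_zero
  set g : EuclideanSpace ℝ (Fin n) → ℝ := fun x => ‖φ x‖ ^ q with hg
  have hg1 : ContDiff ℝ 1 g := hφ.norm_rpow hq
  have hgc : HasCompactSupport g :=
    hc.comp_left (g := fun z : 𝕜 => ‖z‖ ^ q) (by simp [Real.zero_rpow hq0.ne'])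
  have hg'cont : Continuous fun x => fderiv ℝ g x e :=
    (hg1.continuous_fderiv one_ne_zero).clm_apply continuous_const
  have hg'c : HasCompactSupport fun x => fderiv ℝ g x e :=
    (hgc.fderiv ℝ).comp_left (g := fun L : EuclideanSpace ℝ (Fin n) →L[ℝ] ℝ => L e) (by simp)
  have hφ'cont : Continuous fun x => fderiv ℝ φ x e :=
    (hφ.continuous_fderiv one_ne_zero).clm_apply continuous_const
  have hφ'c : HasCompactSupport fun x => fderiv ℝ φ x e :=
    (hc.fderiv ℝ).comp_left (g := fun L : EuclideanSpace ℝ (Fin n) →L[ℝ] 𝕜 => L e) (by simp)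
  have ig : Integrable g := hg1.continuous.integrable_of_hasCompactSupport hgc
  have iφ' : Integrable fun x => ‖fderiv ℝ φ x e‖ ^ q :=
    (hφ'cont.norm.rpow_const fun _ => Or.inr hq0.le).integrable_of_hasCompactSupport
      (hφ'c.comp_left (g := fun z : 𝕜 => ‖z‖ ^ q) (by simp [Real.zero_rpow hq0.ne']))
  have iLg' : Integrable fun x => L x * fderiv ℝ g x e :=
    (L.continuous.mul hg'cont).integrable_of_hasCompactSupport hg'c.mul_left
  have hparts := integral_mul_fderiv_eq_neg_fderiv_mul_of_integrable (μ := volume) (f := L)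
    (g := g) (v := e) (by simpa [L.fderiv, hLe] using ig) iLg'
    ((L.continuous.mul hg1.continuous).integrable_of_hasCompactSupport hgc.mul_left)
    (fun x _ => L.differentiableAt) (fun x _ => hg1.differentiable one_ne_zero x)
  simp only [L.fderiv, hLe, one_mul] at hparts
  have hpt : ∀ x, -(L x * fderiv ℝ g x e) ≤
      (1 - 1 / q) * g x + (q * R) ^ q / q * ‖fderiv ℝ φ x e‖ ^ q := by
    intro x
    by_cases hx : x ∈ tsupport φ
    · have h1 : ‖L x‖ ≤ R := (PiLp.norm_apply_le x i).trans (hs x hx)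
      have h2 : ‖fderiv ℝ g x e‖ ≤ q * (‖φ x‖ ^ (q - 1) * ‖fderiv ℝ φ x e‖) := by
        rw [hg, hd.fderiv_norm_rpow hq, ← rpow_sub_two_mul_self hq (norm_nonneg _)]
        simp only [smul_apply, ContinuousLinearMap.comp_apply, norm_smul,
          norm_mul, innerSL_apply_apply, Real.norm_of_nonneg hq0.le,
          Real.norm_of_nonneg (Real.rpow_nonneg (norm_nonneg (φ x)) (q - 2))]
        rw [mul_assoc, mul_assoc]
        gcongr
        exact norm_inner_le_norm _ _
      -- Putting the factor `q * R` on the derivative leaves the coefficient `1 - 1/q < 1` on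
      -- `|φ|^q`.
      have h3 := rpow_sub_one_mul_le hq (norm_nonneg (φ x))
        (by positivity : 0 ≤ q * R * ‖fderiv ℝ φ x e‖)
      rw [Real.mul_rpow (by positivity) (norm_nonneg _)] at h3
      calc -(L x * fderiv ℝ g x e) ≤ ‖L x‖ * ‖fderiv ℝ g x e‖ := by
            rw [← norm_mul, Real.norm_eq_abs]
            exact neg_le_abs _
        _ ≤ R * (q * (‖φ x‖ ^ (q - 1) * ‖fderiv ℝ φ x e‖)) := by gcongr
        _ = (q * (‖φ x‖ ^ (q - 1) * (q * R * ‖fderiv ℝ φ x e‖))) / q := by field_simp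
        _ ≤ ((q * R) ^ q * ‖fderiv ℝ φ x e‖ ^ q + (q - 1) * ‖φ x‖ ^ q) / q := by gcongr
        _ = _ := by simp only [hg]; field_simp; ring
    · have h0 : fderiv ℝ g x e = 0 := by
        have : x ∉ tsupport fun y => fderiv ℝ g y := fun h =>
          hx (closure_mono (Function.support_comp_subset (g := fun z : 𝕜 => ‖z‖ ^ q)
            (by simp [Real.zero_rpow hq0.ne']) φ) (tsupport_fderiv_subset ℝ h))
        rw [image_eq_zero_of_notMem_tsupport this]
        rfl
      have h1 : 0 ≤ 1 - 1 / q := by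
        rw [sub_nonneg, div_le_one hq0]
        exact hq.le
      have h2 : 0 ≤ g x := by positivity
      rw [h0, mul_zero, neg_zero]
      positivity
  have hmono : -∫ x, L x * fderiv ℝ g x e ≤
      (1 - 1 / q) * (∫ x, g x) + (q * R) ^ q / q * ∫ x, ‖fderiv ℝ φ x e‖ ^ q := by
    rw [← integral_neg, ← integral_const_mul, ← integral_const_mul,
      ← integral_add (ig.const_mul _) (iφ'.const_mul _)]
    exact integral_mono iLg'.neg ((ig.const_mul _).add (iφ'.const_mul _)) hpt
  rw [hparts, neg_neg] at hmono
  have h4 : 1 / q * ∫ x, g x ≤ (q * R) ^ q / q * ∫ x, ‖fderiv ℝ φ x e‖ ^ q := by linarith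
  have h5 := mul_le_mul_of_nonneg_left h4 hq0.le
  calc _ = q * (1 / q * ∫ x, g x) := by field_simp
    _ ≤ _ := h5
    _ = _ := by field_simp

variable [Fact (1 ≤ p)]

/-- For a smooth compactly supported function the weak gradient is the classical one. -/
lemma grad_apply_ae_eq_fderiv (hΩ : IsOpen Ω) {w : Sobolev 𝕜 Ω p}
    {φ : EuclideanSpace ℝ (Fin n) → 𝕜} (hφ : ContDiff ℝ ∞ φ) (hc : HasCompactSupport φ)
    (hs : tsupport φ ⊆ Ω) (hw : toLp w =ᵐ[volume.restrict Ω] φ) (i : Fin n) :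
    ∀ᵐ x ∂volume.restrict Ω, grad w x i = fderiv ℝ φ x (EuclideanSpace.single i 1) := by
  set e : EuclideanSpace ℝ (Fin n) := EuclideanSpace.single i 1 with he
  have hφ'cont : Continuous fun x => fderiv ℝ φ x e :=
    (hφ.continuous_fderiv (by simp)).clm_apply continuous_const
  have hφ'c : HasCompactSupport fun x => fderiv ℝ φ x e :=
    (hc.fderiv ℝ).comp_left (g := fun L : EuclideanSpace ℝ (Fin n) →L[ℝ] 𝕜 => L e) (by simp)
  have hφ'int : Integrable fun x => fderiv ℝ φ x e :=
    hφ'cont.integrable_of_hasCompactSupport hφ'c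
  have hl : LocallyIntegrable (fun x => grad w x i - fderiv ℝ φ x e) (volume.restrict Ω) :=
    ((memLp_coord (grad w) i).locallyIntegrable Fact.out).sub
      hφ'int.restrict.locallyIntegrable
  have hae : ∀ᵐ x, x ∈ Ω → grad w x i - fderiv ℝ φ x e = 0 := by
    refine hΩ.ae_eq_zero_of_integral_contDiff_smul_eq_zero (μ := volume)
      (f := fun x => grad w x i - fderiv ℝ φ x e) ?_ ?_
    · rw [locallyIntegrableOn_iff hΩ.isLocallyClosed]
      intro k hk hkc
      have := hl.integrableOn_isCompact hkc
      rwa [IntegrableOn, Measure.restrict_restrict hkc.measurableSet,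
        Set.inter_eq_self_of_subset_left hk] at this
    · intro ψ hψ hψc hψs
      have hz : ∀ x, x ∉ Ω → ψ x • (grad w x i - fderiv ℝ φ x e) = 0 := by
        intro x hx
        have : ψ x = 0 := image_eq_zero_of_notMem_tsupport (fun hm => hx (hψs hm))
        simp [this]
      have hz1 : ∀ x, x ∉ Ω → ψ x • fderiv ℝ φ x e = 0 := by
        intro x hx
        have : ψ x = 0 := image_eq_zero_of_notMem_tsupport (fun hm => hx (hψs hm))
        simp [this]
      have hz2 : ∀ x, x ∉ Ω → fderiv ℝ ψ x e • φ x = 0 := by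
        intro x hx
        have : φ x = 0 := image_eq_zero_of_notMem_tsupport (fun hm => hx (hs hm))
        simp [this]
      have i1 : Integrable fun x => ψ x • fderiv ℝ φ x e :=
        (hψ.continuous.smul hφ'cont).integrable_of_hasCompactSupport hφ'c.smul_left
      rw [← setIntegral_eq_integral_of_forall_compl_eq_zero hz]
      simp only [smul_sub]
      rw [integral_sub
        (integrable_smul_of_memLp Fact.out hψ.continuous hψc (memLp_coord (grad w) i))
        i1.restrict, sub_eq_zero]
      have h1 := w.2 ψ hψ hψc hψs i
      have h2 : ∫ x in Ω, fderiv ℝ ψ x e • w.1.fst x = ∫ x in Ω, fderiv ℝ ψ x e • φ x :=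
        integral_congr_ae (hw.mono fun x hx => by
          have hx' : w.1.fst x = φ x := hx
          simp only [hx'])
      -- The supports of `φ` and `ψ` lie in `Ω`, so integrals over `Ω` become integrals over the
      -- whole space and there is no boundary term.
      have h3 := integral_smul_fderiv_eq_neg_fderiv_smul_of_integrable (μ := volume) (f := ψ)
        (g := φ) (v := e)
        (((continuous_partial hψ e).smul hφ.continuous).integrable_of_hasCompactSupport
          hc.smul_left) i1
        ((hψ.continuous.smul hφ.continuous).integrable_of_hasCompactSupport hc.smul_left)
        (fun x _ => hψ.differentiable (by simp) x) (fun x _ => hφ.differentiable (by simp) x)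
      rw [setIntegral_eq_integral_of_forall_compl_eq_zero hz1, h3,
        ← setIntegral_eq_integral_of_forall_compl_eq_zero hz2, ← h2]
      exact neg_eq_iff_eq_neg.mp h1.symm
  filter_upwards [(ae_restrict_iff' hΩ.measurableSet).mpr hae] with x hx
  exact sub_eq_zero.mp hx

lemma continuous_toLp : Continuous (toLp : Sobolev 𝕜 Ω p → Lp 𝕜 p (volume.restrict Ω)) :=
  continuous_fst_LpPair.comp continuous_subtype_val

lemma continuous_grad : Continuous
    (grad : Sobolev 𝕜 Ω p → Lp (EuclideanSpace 𝕜 (Fin n)) p (volume.restrict Ω)) :=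
  continuous_snd_LpPair.comp continuous_subtype_val

/-- The Poincaré inequality on `W^{1,p}_0` of a bounded open set. -/
lemma exists_norm_toLp_le_norm_grad (hn : 1 ≤ n) (hΩ : IsOpen Ω) (hΩb : Bornology.IsBounded Ω)
    (hp₁ : 1 < p) (hp₂ : p < ⊤) :
    ∃ C : ℝ, 0 ≤ C ∧ ∀ w ∈ Sobolev₀ 𝕜 Ω p, ‖toLp w‖ ≤ C * ‖grad w‖ := by
  have hq := one_lt_toReal hp₁ hp₂
  have hq0 : 0 < p.toReal := by linarith
  obtain ⟨R, hR⟩ := hΩb.exists_norm_le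
  set R' := max R 0 with hR'
  have hR0 : 0 ≤ R' := le_max_right _ _
  have hcl : IsClosed {w : Sobolev 𝕜 Ω p | ‖toLp w‖ ≤ p.toReal * R' * ‖grad w‖} :=
    isClosed_le continuous_toLp.norm (continuous_const.mul continuous_grad.norm)
  -- Both sides are continuous on `W^{1,p}`, so the inequality passes from `C_c^∞` to its closure.
  refine ⟨p.toReal * R', by positivity, fun w hw => closure_minimal ?_ hcl hw⟩
  rintro w ⟨φ, hφ, hc, hs, hae⟩
  -- One coordinate direction suffices, and `1 ≤ n` provides it.
  set i : Fin n := ⟨0, hn⟩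
  have hgrad := grad_apply_ae_eq_fderiv hΩ hφ hc hs hae i
  have hmain := integral_norm_rpow_le_integral_norm_fderiv hq hR0 (hφ.of_le (by simp)) hc
    (fun x hx => (hR x (hs hx)).trans (le_max_left _ _)) i
  have e1 : ‖toLp w‖ ^ p.toReal = ∫ x, ‖φ x‖ ^ p.toReal := by
    rw [Lp_norm_rpow_eq_integral hp₁ hp₂, ← setIntegral_eq_integral_of_forall_compl_eq_zero
      (s := Ω) (f := fun x => ‖φ x‖ ^ p.toReal)]
    · exact integral_congr_ae (hae.mono fun x hx => by simp only [hx])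
    · intro x hx
      rw [image_eq_zero_of_notMem_tsupport fun h => hx (hs h), norm_zero, Real.zero_rpow hq0.ne']
  have e2 : ∫ x, ‖fderiv ℝ φ x (EuclideanSpace.single i 1)‖ ^ p.toReal ≤
      ‖grad w‖ ^ p.toReal := by
    rw [Lp_norm_rpow_eq_integral hp₁ hp₂, ← setIntegral_eq_integral_of_forall_compl_eq_zero
      (s := Ω)]
    · refine integral_mono_of_nonneg (ae_of_all _ fun x => by positivity)
        (integrable_norm_rpow_toReal hp₁ hp₂ (Lp.memLp (grad w))) ?_
      filter_upwards [hgrad] with x hx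
      rw [← hx]
      exact Real.rpow_le_rpow (norm_nonneg _) (PiLp.norm_apply_le _ i) hq0.le
    · intro x hx
      have : x ∉ tsupport fun y => fderiv ℝ φ y := fun h => hx (hs (tsupport_fderiv_subset ℝ h))
      rw [image_eq_zero_of_notMem_tsupport this]
      simp [Real.zero_rpow hq0.ne']
  have h3 : ‖toLp w‖ ^ p.toReal ≤ (p.toReal * R' * ‖grad w‖) ^ p.toReal := by
    rw [Real.mul_rpow (by positivity) (norm_nonneg _), e1]
    exact hmain.trans (by gcongr)
  exact (Real.rpow_le_rpow_iff (norm_nonneg _) (by positivity) hq0).mp h3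

end Poincare

/-! ### The first variation of the weighted energy. -/

section Flux

open Filter Topology

variable {α : Type*} [MeasurableSpace α] {μ : Measure α} {𝕜 : Type*} [RCLike 𝕜] {E : Type*}
  [NormedAddCommGroup E] [InnerProductSpace 𝕜 E] {p : ℝ≥0∞} {γ : α → ℝ} {c M : ℝ}

lemma norm_rpow_sub_two_mul_norm_inner_le {q : ℝ} (hq : 1 < q) (a b : E) :
    ‖a‖ ^ (q - 2) * ‖inner 𝕜 b a‖ ≤ (‖a‖ + ‖b‖) ^ q := by
  calc ‖a‖ ^ (q - 2) * ‖inner 𝕜 b a‖ ≤ ‖a‖ ^ (q - 2) * (‖b‖ * ‖a‖) := by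
        gcongr
        exact norm_inner_le_norm b a
    _ = ‖a‖ ^ (q - 1) * ‖b‖ := by rw [← rpow_sub_two_mul_self hq (norm_nonneg a)]; ring
    _ ≤ (‖a‖ + ‖b‖) ^ (q - 1) * (‖a‖ + ‖b‖) := by
        gcongr
        · linarith [norm_nonneg b]
        · linarith [norm_nonneg a]
    _ = _ := rpow_sub_one_mul_self hq (by positivity)

lemma integrable_add_norm_rpow (hp₁ : 1 < p) (hp₂ : p < ⊤) {a b : α → E} (ha : MemLp a p μ)
    (hb : MemLp b p μ) : Integrable (fun x => (‖a x‖ + ‖b x‖) ^ p.toReal) μ := by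
  have h := integrable_norm_rpow_toReal hp₁ hp₂ (ha.norm.add hb.norm)
  refine h.congr (ae_of_all _ fun x => ?_)
  simp only [Pi.add_apply]
  rw [Real.norm_of_nonneg (by positivity)]

lemma aestronglyMeasurable_norm_rpow_smul_inner (r : ℝ) {a b : α → E}
    (ha : AEStronglyMeasurable a μ) (hb : AEStronglyMeasurable b μ) :
    AEStronglyMeasurable (fun x => ‖a x‖ ^ r • inner 𝕜 (b x) (a x)) μ :=
  (ha.norm.aemeasurable.pow_const r).aestronglyMeasurable.smul (hb.inner ha)

lemma integrable_flux (hw : IsBddWeight μ γ c M) (hp₁ : 1 < p) (hp₂ : p < ⊤) {a b : α → E}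
    (ha : MemLp a p μ) (hb : MemLp b p μ) :
    Integrable (fun x => (γ x * ‖a x‖ ^ (p.toReal - 2)) • inner 𝕜 (b x) (a x)) μ := by
  have h : Integrable (fun x => ‖a x‖ ^ (p.toReal - 2) • inner 𝕜 (b x) (a x)) μ := by
    refine (integrable_add_norm_rpow hp₁ hp₂ ha hb).mono'
      (aestronglyMeasurable_norm_rpow_smul_inner _ ha.1 hb.1) (ae_of_all _ fun x => ?_)
    rw [norm_smul, Real.norm_of_nonneg (by positivity)]
    exact norm_rpow_sub_two_mul_norm_inner_le (one_lt_toReal hp₁ hp₂) (a x) (b x)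
  simp only [mul_smul]
  exact h.bdd_smul M hw.meas hw.norm_le

/-- The first variation of the weighted energy at `a` in direction `b`, up to the factor `q`. -/
noncomputable def weightedFlux (𝕜 : Type*) [RCLike 𝕜] [InnerProductSpace 𝕜 E] (μ : Measure α)
    (γ : α → ℝ) (q : ℝ) (a b : α → E) : ℝ :=
  ∫ x, γ x * (‖a x‖ ^ (q - 2) * RCLike.re (inner 𝕜 (b x) (a x))) ∂μ

lemma re_flux_apply {α : Type*} {γ : α → ℝ} (q : ℝ) (a b : α → E) (x : α) :
    RCLike.re ((γ x * ‖a x‖ ^ (q - 2)) • inner 𝕜 (b x) (a x)) =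
      γ x * (‖a x‖ ^ (q - 2) * RCLike.re (inner 𝕜 (b x) (a x))) := by
  rw [RCLike.smul_re, mul_assoc]

lemma integrable_re_flux (hw : IsBddWeight μ γ c M) (hp₁ : 1 < p) (hp₂ : p < ⊤) {a b : α → E}
    (ha : MemLp a p μ) (hb : MemLp b p μ) :
    Integrable (fun x => γ x * (‖a x‖ ^ (p.toReal - 2) * RCLike.re (inner 𝕜 (b x) (a x)))) μ :=
  (integrable_flux (𝕜 := 𝕜) hw hp₁ hp₂ ha hb).re.congr (ae_of_all _ (re_flux_apply _ a b))

lemma weightedFlux_eq_re_integral (hw : IsBddWeight μ γ c M) (hp₁ : 1 < p) (hp₂ : p < ⊤)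
    {a b : α → E} (ha : MemLp a p μ) (hb : MemLp b p μ) :
    weightedFlux 𝕜 μ γ p.toReal a b =
      RCLike.re (∫ x, (γ x * ‖a x‖ ^ (p.toReal - 2)) • inner 𝕜 (b x) (a x) ∂μ) := by
  rw [← integral_re (integrable_flux hw hp₁ hp₂ ha hb)]
  exact integral_congr_ae (ae_of_all _ fun x => (re_flux_apply _ a b x).symm)

lemma weightedFlux_congr {q : ℝ} {a b b' : α → E} (h : b =ᵐ[μ] b') :
    weightedFlux 𝕜 μ γ q a b = weightedFlux 𝕜 μ γ q a b' :=
  integral_congr_ae (h.mono fun x hx => by simp only [hx])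

lemma weightedFlux_ofReal_smul {q : ℝ} (t : ℝ) (a b : α → E) :
    weightedFlux 𝕜 μ γ q a ((t : 𝕜) • b) = t * weightedFlux 𝕜 μ γ q a b := by
  unfold weightedFlux
  rw [← integral_const_mul]
  refine integral_congr_ae (ae_of_all _ fun x => ?_)
  simp only [Pi.smul_apply, inner_smul_left, RCLike.conj_ofReal, RCLike.re_ofReal_mul]
  ring

lemma weightedEnergy_add_flux_le (hw : IsBddWeight μ γ c M) (hp₁ : 1 < p) (hp₂ : p < ⊤)
    {a b : α → E} (ha : MemLp a p μ) (hb : MemLp b p μ) :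
    weightedEnergy μ γ p.toReal a + p.toReal * weightedFlux 𝕜 μ γ p.toReal a (b - a) ≤
      weightedEnergy μ γ p.toReal b := by
  have ia := weightedEnergy_integrable hw hp₁ hp₂ ha
  have ij := integrable_re_flux (𝕜 := 𝕜) hw hp₁ hp₂ ha (hb.sub ha)
  unfold weightedEnergy weightedFlux
  rw [← integral_const_mul, ← integral_add ia (ij.const_mul _)]
  apply integral_mono_ae (ia.add (ij.const_mul _)) (weightedEnergy_integrable hw hp₁ hp₂ hb)
  filter_upwards [hw.lower] with x hx
  have h := mul_le_mul_of_nonneg_left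
    (norm_rpow_gradient_le (𝕜 := 𝕜) (one_lt_toReal hp₁ hp₂) (a x) (b x)) (hw.pos.le.trans hx)
  simp only [Pi.add_apply, Pi.sub_apply]
  linarith

/-- The energy is never differentiated. The tangent inequality based at `a + t b` and compared with
`a`, together with minimality, shows that the flux at `a + t b` in direction `b` is nonnegative;
dominated convergence as `t → 0` gives the claim. -/
lemma weightedFlux_nonneg_of_minimal (hw : IsBddWeight μ γ c M) (hp₁ : 1 < p) (hp₂ : p < ⊤)
    {a b : α → E} (ha : MemLp a p μ) (hb : MemLp b p μ)
    (hmin : ∀ t : ℝ, weightedEnergy μ γ p.toReal a ≤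
      weightedEnergy μ γ p.toReal (a + (t : 𝕜) • b)) :
    0 ≤ weightedFlux 𝕜 μ γ p.toReal a b := by
  have hq := one_lt_toReal hp₁ hp₂
  set t : ℕ → ℝ := fun k => 1 / ((k : ℝ) + 1) with ht
  have htpos : ∀ k, 0 < t k := fun k => Nat.one_div_pos_of_nat
  have htle : ∀ k, t k ≤ 1 := fun k => by
    rw [ht, div_le_one (by positivity)]
    linarith [Nat.cast_nonneg (α := ℝ) k]
  have hA : ∀ k, MemLp (a + (t k : 𝕜) • b) p μ := fun k => ha.add (hb.const_smul _)
  have hpos : ∀ k, 0 ≤ weightedFlux 𝕜 μ γ p.toReal (a + (t k : 𝕜) • b) b := by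
    intro k
    have h1 := weightedEnergy_add_flux_le (𝕜 := 𝕜) hw hp₁ hp₂ (hA k) ha
    have h2 : a - (a + (t k : 𝕜) • b) = ((-t k : ℝ) : 𝕜) • b := by
      rw [RCLike.ofReal_neg, neg_smul]
      abel
    rw [h2, weightedFlux_ofReal_smul] at h1
    have h3 : p.toReal * (-t k * weightedFlux 𝕜 μ γ p.toReal (a + (t k : 𝕜) • b) b) ≤ 0 := by
      linarith [hmin (t k)]
    by_contra! hneg
    have : 0 < p.toReal * (-t k * weightedFlux 𝕜 μ γ p.toReal (a + (t k : 𝕜) • b) b) :=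
      mul_pos (by linarith) (mul_pos_of_neg_of_neg (by linarith [htpos k]) hneg)
    linarith
  refine ge_of_tendsto' (f := fun k : ℕ => weightedFlux 𝕜 μ γ p.toReal (a + (t k : 𝕜) • b) b)
    (x := atTop) ?_ hpos
  unfold weightedFlux
  -- Dominates every integrand because `0 < t k ≤ 1` gives `‖a + t b‖ ≤ ‖a‖ + ‖b‖`.
  have hbd : Integrable (fun x => M * ((‖a x‖ + ‖b x‖) + ‖b x‖) ^ p.toReal) μ := by
    have := (integrable_add_norm_rpow hp₁ hp₂ (ha.norm.add hb.norm) hb.norm).const_mul M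
    refine this.congr (ae_of_all _ fun x => ?_)
    simp only [Pi.add_apply, norm_norm]
    rw [Real.norm_of_nonneg (by positivity)]
  refine tendsto_integral_of_dominated_convergence _
    (fun k => (integrable_re_flux (𝕜 := 𝕜) hw hp₁ hp₂ (hA k) hb).aestronglyMeasurable) hbd
    (fun k => ?_) ?_
  · filter_upwards [hw.norm_le] with x hx
    rw [norm_mul]
    have hM : 0 ≤ M := (norm_nonneg _).trans hx
    gcongr
    rw [norm_mul, Real.norm_of_nonneg (by positivity)]
    have h1 : ‖RCLike.re (inner 𝕜 (b x) ((a + (t k : 𝕜) • b) x))‖ ≤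
        ‖inner 𝕜 (b x) ((a + (t k : 𝕜) • b) x)‖ := by
      rw [Real.norm_eq_abs]
      exact RCLike.abs_re_le_norm _
    refine (mul_le_mul_of_nonneg_left h1 (by positivity)).trans
      ((norm_rpow_sub_two_mul_norm_inner_le hq _ _).trans ?_)
    gcongr
    simp only [Pi.add_apply, Pi.smul_apply]
    refine (norm_add_le _ _).trans ?_
    rw [norm_smul, RCLike.norm_ofReal, abs_of_pos (htpos k)]
    gcongr
    exact mul_le_of_le_one_left (norm_nonneg _) (htle k)
  · refine ae_of_all _ fun x => Tendsto.const_mul _ ?_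
    have hlim : Tendsto (fun k => (a + (t k : 𝕜) • b) x) atTop (𝓝 (a x)) := by
      have h1 : Tendsto (fun k => (t k : 𝕜)) atTop (𝓝 0) := by
        have := (RCLike.continuous_ofReal (K := 𝕜)).tendsto 0
        rw [RCLike.ofReal_zero] at this
        exact this.comp tendsto_one_div_add_atTop_nhds_zero_nat
      simpa using tendsto_const_nhds.add (h1.smul_const (b x))
    exact ((continuous_norm_rpow_mul_re_inner (𝕜 := 𝕜) hq (b x)).tendsto (a x)).comp hlim

end Flux

/-! ### The Dirichlet problem: minimizers, weak solutions and the norm bound. -/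

section Dirichlet

variable {𝕜 : Type*} [RCLike 𝕜] {n : ℕ} {Ω : Set (EuclideanSpace ℝ (Fin n))} {p : ℝ≥0∞}
  [Fact (1 ≤ p)] {γ : EuclideanSpace ℝ (Fin n) → ℝ} {c M : ℝ}

lemma exists_isBddWeight (hγ : MemLp γ ⊤ (volume.restrict Ω))
    (hγpos : ∃ c : ℝ, 0 < c ∧ ∀ᵐ x ∂(volume.restrict Ω), c ≤ γ x) :
    ∃ c M : ℝ, 0 ≤ M ∧ IsBddWeight (volume.restrict Ω) γ c M := by
  obtain ⟨c, hc, hle⟩ := hγpos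
  have hfin : eLpNormEssSup γ (volume.restrict Ω) ≠ ⊤ := by
    simpa using hγ.2.ne
  refine ⟨c, (eLpNormEssSup γ (volume.restrict Ω)).toReal, ENNReal.toReal_nonneg,
    hγ.1, hc, hle, ?_⟩
  filter_upwards [ae_le_eLpNormEssSup (f := γ) (μ := volume.restrict Ω)] with x hx
  refine (Real.le_norm_self _).trans ?_
  rw [← toReal_enorm]
  exact ENNReal.toReal_mono hfin hx

lemma norm_sobolev_le (w : Sobolev 𝕜 Ω p) : ‖w‖ ≤ ‖toLp w‖ + ‖grad w‖ := by
  have h : w.1 = WithLp.toLp p (w.1.fst, 0) + WithLp.toLp p (0, w.1.snd) := by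
    rw [← WithLp.toLp_add, Prod.mk_add_mk, add_zero, zero_add]
    rfl
  calc ‖w‖ = ‖w.1‖ := rfl
    _ ≤ _ := by
      conv_lhs => rw [h]
      refine (norm_add_le _ _).trans ?_
      rw [WithLp.norm_toLp_fst, WithLp.norm_toLp_snd]
      exact le_rfl

lemma norm_toLp_le (w : Sobolev 𝕜 Ω p) : ‖toLp w‖ ≤ ‖w‖ := WithLp.norm_fst_le _ w.1

lemma norm_grad_le (w : Sobolev 𝕜 Ω p) : ‖grad w‖ ≤ ‖w‖ := WithLp.norm_snd_le _ w.1

lemma energy_eq_weightedEnergy (v : Sobolev 𝕜 Ω p) :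
    energy γ v = weightedEnergy (volume.restrict Ω) γ p.toReal (grad v) := rfl

/-- The weak gradients of the functions with the boundary values of `f`. -/
def admissibleGradients (f : Sobolev 𝕜 Ω p) :
    Set (Lp (EuclideanSpace 𝕜 (Fin n)) p (volume.restrict Ω)) :=
  {g | ∃ v : Sobolev 𝕜 Ω p, v - f ∈ Sobolev₀ 𝕜 Ω p ∧ grad v = g}

lemma grad_add (u v : Sobolev 𝕜 Ω p) : grad (u + v) = grad u + grad v := rfl

lemma grad_sub (u v : Sobolev 𝕜 Ω p) : grad (u - v) = grad u - grad v := rfl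

lemma grad_smul (z : 𝕜) (u : Sobolev 𝕜 Ω p) : grad (z • u) = z • grad u := rfl

/-- By Poincaré the gradient is bounded below on the complete space `W^{1,p}_0`, so its range is
closed; the admissible gradients are a translate of that range. -/
lemma isClosed_admissibleGradients (hΩb : Bornology.IsBounded Ω) {C : ℝ} (hC : 0 ≤ C)
    (hP : ∀ w ∈ Sobolev₀ 𝕜 Ω p, ‖toLp w‖ ≤ C * ‖grad w‖) (f : Sobolev 𝕜 Ω p) :
    IsClosed (admissibleGradients f) := by
  have := completeSpace_sobolev₀ (𝕜 := 𝕜) (p := p) hΩb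
  set T : Sobolev₀ 𝕜 Ω p →L[𝕜] Lp (EuclideanSpace 𝕜 (Fin n)) p (volume.restrict Ω) :=
    (WithLp.sndL p 𝕜 (Lp 𝕜 p (volume.restrict Ω))
      (Lp (EuclideanSpace 𝕜 (Fin n)) p (volume.restrict Ω))).comp
      ((Sobolev 𝕜 Ω p).subtypeL.comp (Sobolev₀ 𝕜 Ω p).subtypeL)
  have hTapp : ∀ w, T w = grad w.1 := fun w => rfl
  have hanti : AntilipschitzWith (C + 1).toNNReal T := by
    refine T.antilipschitz_of_bound fun w => ?_
    have h1 := norm_sobolev_le w.1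
    have h2 := hP w.1 w.2
    rw [hTapp, Real.coe_toNNReal _ (by positivity)]
    change ‖w.1‖ ≤ _
    linarith
  have hrange := hanti.isClosed_range T.uniformContinuous
  have heq : admissibleGradients f = (fun g => g - grad f) ⁻¹'
      Set.range T := by
    ext g
    constructor
    · rintro ⟨v, hv, rfl⟩
      exact ⟨⟨v - f, hv⟩, grad_sub v f⟩
    · rintro ⟨w, hw⟩
      refine ⟨f + w.1, by simp, ?_⟩
      have hw' : grad w.1 = g - grad f := hw
      rw [grad_add, hw', add_sub_cancel]
  rw [heq]
  exact hrange.preimage (continuous_id.sub continuous_const)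

lemma midpoint_mem_admissibleGradients (f : Sobolev 𝕜 Ω p) :
    ∀ a ∈ admissibleGradients f, ∀ b ∈ admissibleGradients f,
      (1 / 2 : ℝ) • (a + b) ∈ admissibleGradients f := by
  rintro _ ⟨u, hu, rfl⟩ _ ⟨v, hv, rfl⟩
  refine ⟨(1 / 2 : 𝕜) • (u + v), ?_, ?_⟩
  · have h : (1 / 2 : 𝕜) • (u + v) - f = (1 / 2 : 𝕜) • ((u - f) + (v - f)) := by
      module
    rw [h]
    exact Submodule.smul_mem _ _ (Submodule.add_mem _ hu hv)
  · rw [grad_smul, grad_add]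
    apply Lp.ext
    filter_upwards [Lp.coeFn_smul (1 / 2 : 𝕜) (grad u + grad v),
      Lp.coeFn_smul (1 / 2 : ℝ) (grad u + grad v)] with x h1 h2
    rw [h1, h2]
    ext i
    simp [RCLike.real_smul_eq_coe_mul, map_ofNat (algebraMap ℝ 𝕜) 2]

lemma isEnergyMinimizer_iff (f u : Sobolev 𝕜 Ω p) :
    IsEnergyMinimizer γ f u ↔ u - f ∈ Sobolev₀ 𝕜 Ω p ∧ ∀ g ∈ admissibleGradients f,
      weightedEnergy (volume.restrict Ω) γ p.toReal (grad u) ≤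
        weightedEnergy (volume.restrict Ω) γ p.toReal g := by
  refine and_congr_right fun _ => ⟨?_, fun h v hv => h _ ⟨v, hv, rfl⟩⟩
  rintro h _ ⟨v, hv, rfl⟩
  exact h v hv

/-- The difference lies in `W^{1,p}_0` and has zero gradient, so Poincaré kills it. -/
lemma eq_of_grad_eq {C : ℝ} (hP : ∀ w ∈ Sobolev₀ 𝕜 Ω p, ‖toLp w‖ ≤ C * ‖grad w‖)
    {f u v : Sobolev 𝕜 Ω p} (hu : u - f ∈ Sobolev₀ 𝕜 Ω p) (hv : v - f ∈ Sobolev₀ 𝕜 Ω p)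
    (h : grad u = grad v) : u = v := by
  have hmem : u - v ∈ Sobolev₀ 𝕜 Ω p := by
    have := Submodule.sub_mem _ hu hv
    rwa [sub_sub_sub_cancel_right] at this
  have h1 := hP _ hmem
  have h2 := norm_sobolev_le (u - v)
  rw [grad_sub, h, sub_self, norm_zero] at h1 h2
  have h3 : ‖u - v‖ = 0 := le_antisymm (by linarith) (norm_nonneg _)
  rwa [norm_eq_zero, sub_eq_zero] at h3

lemma isEnergyMinimizer_unique (hw : IsBddWeight (volume.restrict Ω) γ c M) (hp₁ : 1 < p)
    (hp₂ : p < ⊤) {C : ℝ} (hP : ∀ w ∈ Sobolev₀ 𝕜 Ω p, ‖toLp w‖ ≤ C * ‖grad w‖)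
    {f u v : Sobolev 𝕜 Ω p} (hu : IsEnergyMinimizer γ f u) (hv : IsEnergyMinimizer γ f v) :
    u = v := by
  rw [isEnergyMinimizer_iff] at hu hv
  exact eq_of_grad_eq hP hu.1 hv.1 (eq_of_weightedEnergy_minimal hw hp₁ hp₂
    (midpoint_mem_admissibleGradients f) ⟨u, hu.1, rfl⟩ ⟨v, hv.1, rfl⟩ hu.2 hv.2)

lemma exists_isEnergyMinimizer (hΩb : Bornology.IsBounded Ω)
    (hw : IsBddWeight (volume.restrict Ω) γ c M) (hp₁ : 1 < p) (hp₂ : p < ⊤) {C : ℝ} (hC : 0 ≤ C)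
    (hP : ∀ w ∈ Sobolev₀ 𝕜 Ω p, ‖toLp w‖ ≤ C * ‖grad w‖) (f : Sobolev 𝕜 Ω p) :
    ∃ u : Sobolev 𝕜 Ω p, IsEnergyMinimizer γ f u := by
  obtain ⟨_, ⟨u, hu, rfl⟩, hmin⟩ := exists_weightedEnergy_minimal hw hp₁ hp₂
    (A := admissibleGradients f) ⟨grad f, f, by simp, rfl⟩ (isClosed_admissibleGradients hΩb hC hP f)
    (midpoint_mem_admissibleGradients f)
  exact ⟨u, (isEnergyMinimizer_iff f u).mpr ⟨hu, hmin⟩⟩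

lemma sum_mul_conjVec (a b : EuclideanSpace 𝕜 (Fin n)) :
    ∑ i, a i * conjVec 𝕜 n b i = inner 𝕜 b a := by
  simp only [PiLp.inner_apply, RCLike.inner_apply, conjVec_apply]

lemma conjVec_conjVec (a : EuclideanSpace 𝕜 (Fin n)) : conjVec 𝕜 n (conjVec 𝕜 n a) = a := by
  ext i
  simp [conjVec_apply]

/-- A weak solution is characterized by the vanishing of the first variation of the energy. -/
lemma isWeakSolution_iff (hw : IsBddWeight (volume.restrict Ω) γ c M) (hp₁ : 1 < p)
    (hp₂ : p < ⊤) (f u : Sobolev 𝕜 Ω p) :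
    IsWeakSolution γ f u ↔ u - f ∈ Sobolev₀ 𝕜 Ω p ∧ ∀ ψ ∈ Sobolev₀ 𝕜 Ω p,
      weightedFlux 𝕜 (volume.restrict Ω) γ p.toReal (grad u) (grad ψ) = 0 := by
  refine and_congr_right fun _ => ⟨fun h ψ hψ => ?_, fun h φ hφ => ?_⟩
  · rw [weightedFlux_eq_re_integral hw hp₁ hp₂ (Lp.memLp _) (Lp.memLp _)]
    have h1 := h _ (conjSobolev_mem_sobolev₀ hψ)
    have h2 : ∫ x in Ω, (γ x * ‖grad u x‖ ^ (p.toReal - 2)) • inner 𝕜 (grad ψ x) (grad u x) =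
        0 := by
      refine Eq.trans (integral_congr_ae ?_) h1
      filter_upwards [grad_conjSobolev ψ] with x hx
      rw [hx, sum_mul_conjVec]
    rw [h2, map_zero]
  · set ψ := conjSobolev φ with hψdef
    have hψ : ψ ∈ Sobolev₀ 𝕜 Ω p := conjSobolev_mem_sobolev₀ hφ
    set z : 𝕜 := ∫ x in Ω, (γ x * ‖grad u x‖ ^ (p.toReal - 2)) •
      inner 𝕜 (grad ψ x) (grad u x) with hz
    -- The hypothesis only controls real parts. Testing with `z • ψ`, where `z` is the full
    -- integral, turns it into `|z|^2 = 0`.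
    have h1 := h (z • ψ) (Submodule.smul_mem _ z hψ)
    rw [weightedFlux_eq_re_integral hw hp₁ hp₂ (Lp.memLp _) (Lp.memLp _)] at h1
    have h2 : ∫ x in Ω, (γ x * ‖grad u x‖ ^ (p.toReal - 2)) •
        inner 𝕜 (grad (z • ψ) x) (grad u x) = starRingEnd 𝕜 z * z := by
      conv_rhs => rw [hz, ← integral_const_mul, ← hz]
      refine integral_congr_ae ?_
      filter_upwards [Lp.coeFn_smul z (grad ψ)] with x hx
      rw [grad_smul, hx, Pi.smul_apply, inner_smul_left, mul_smul_comm]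
    rw [h2, RCLike.conj_mul, ← RCLike.ofReal_pow, RCLike.ofReal_re] at h1
    have hz0 : z = 0 := by simpa using h1
    refine Eq.trans (integral_congr_ae ?_) hz0
    filter_upwards [grad_conjSobolev φ] with x hx
    rw [hx, ← sum_mul_conjVec, conjVec_conjVec]

/-- If the first variation vanishes, the tangent inequality at `u` gives minimality. Conversely, a
minimizer has nonnegative first variation in the directions `ψ` and `-ψ`, hence zero. -/
lemma isWeakSolution_iff_isEnergyMinimizer (hw : IsBddWeight (volume.restrict Ω) γ c M)
    (hp₁ : 1 < p) (hp₂ : p < ⊤) (f u : Sobolev 𝕜 Ω p) :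
    IsWeakSolution γ f u ↔ IsEnergyMinimizer γ f u := by
  rw [isWeakSolution_iff hw hp₁ hp₂]
  refine and_congr_right fun hu => ⟨fun h v hv => ?_, fun h => ?_⟩
  · have hmem : v - u ∈ Sobolev₀ 𝕜 Ω p := by
      have := Submodule.sub_mem _ hv hu
      rwa [sub_sub_sub_cancel_right] at this
    have h1 := weightedEnergy_add_flux_le (𝕜 := 𝕜) hw hp₁ hp₂ (Lp.memLp (grad u))
      (Lp.memLp (grad v))
    rw [← weightedFlux_congr (Lp.coeFn_sub (grad v) (grad u)), ← grad_sub, h _ hmem, mul_zero,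
      add_zero] at h1
    exact h1
  · have hnonneg : ∀ ψ ∈ Sobolev₀ 𝕜 Ω p,
        0 ≤ weightedFlux 𝕜 (volume.restrict Ω) γ p.toReal (grad u) (grad ψ) := by
      intro ψ hψ
      refine weightedFlux_nonneg_of_minimal hw hp₁ hp₂ (Lp.memLp _) (Lp.memLp _) fun t => ?_
      have hmem : (u + (t : 𝕜) • ψ) - f ∈ Sobolev₀ 𝕜 Ω p := by
        rw [add_sub_right_comm]
        exact Submodule.add_mem _ hu (Submodule.smul_mem _ _ hψ)
      have h1 := h _ hmem
      rw [energy_eq_weightedEnergy, energy_eq_weightedEnergy, grad_add, grad_smul] at h1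
      refine h1.trans_eq (weightedEnergy_congr ?_)
      exact (Lp.coeFn_add _ _).trans
        (Filter.EventuallyEq.rfl.add (Lp.coeFn_smul (t : 𝕜) (grad ψ)))
    intro ψ hψ
    refine le_antisymm ?_ (hnonneg ψ hψ)
    have h1 := hnonneg _ (Submodule.smul_mem _ ((-1 : ℝ) : 𝕜) hψ)
    rw [grad_smul, weightedFlux_congr (Lp.coeFn_smul _ (grad ψ)), weightedFlux_ofReal_smul] at h1
    linarith

lemma norm_grad_le_of_energy_le (hw : IsBddWeight (volume.restrict Ω) γ c M) (hM : 0 ≤ M)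
    (hp₁ : 1 < p) (hp₂ : p < ⊤) {u f : Sobolev 𝕜 Ω p} (h : energy γ u ≤ energy γ f) :
    ‖grad u‖ ≤ (M / c) ^ (1 / p.toReal) * ‖grad f‖ := by
  have hq := one_lt_toReal hp₁ hp₂
  have hc := hw.pos
  have h1 := mul_norm_rpow_le_weightedEnergy hw hp₁ hp₂ (grad u)
  have h2 := weightedEnergy_le_mul_norm_rpow hw hp₁ hp₂ (grad f)
  have h3 : c * ‖grad u‖ ^ p.toReal ≤ M * ‖grad f‖ ^ p.toReal := h1.trans (h.trans h2)
  refine (Real.rpow_le_rpow_iff (norm_nonneg _) (by positivity) (by linarith : 0 < p.toReal)).mp ?_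
  rw [Real.mul_rpow (by positivity) (norm_nonneg _), ← Real.rpow_mul (by positivity),
    one_div, inv_mul_cancel₀ (by linarith), Real.rpow_one, div_mul_eq_mul_div, le_div_iff₀ hc,
    mul_comm]
  exact h3

end Dirichlet

theorem propositionA1 {𝕜 : Type*} [RCLike 𝕜] {n : ℕ} (hn : 1 ≤ n)
    (Ω : Set (EuclideanSpace ℝ (Fin n))) (hΩ : IsOpen Ω) (hΩb : Bornology.IsBounded Ω)
    (p : ℝ≥0∞) [Fact (1 ≤ p)] (hp₁ : 1 < p) (hp₂ : p < ⊤)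
    (γ : EuclideanSpace ℝ (Fin n) → ℝ) (hγ : MemLp γ ⊤ (volume.restrict Ω))
    (hγpos : ∃ c : ℝ, 0 < c ∧ ∀ᵐ x ∂(volume.restrict Ω), c ≤ γ x) :
    ∃ C : ℝ, 0 < C ∧ ∀ f : Sobolev 𝕜 Ω p, ∃ u : Sobolev 𝕜 Ω p,
      (IsWeakSolution γ f u ∧ ∀ v : Sobolev 𝕜 Ω p, IsWeakSolution γ f v → v = u) ∧
      ‖u‖ ≤ C * ‖f‖ ∧
      (IsEnergyMinimizer γ f u ∧ ∀ v : Sobolev 𝕜 Ω p, IsEnergyMinimizer γ f v → v = u) := by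

  obtain ⟨c, M, hM, hw⟩ := exists_isBddWeight hγ hγpos
  obtain ⟨A, hA, hP⟩ := exists_norm_toLp_le_norm_grad (𝕜 := 𝕜) hn hΩ hΩb hp₁ hp₂
  have hc := hw.pos
  set D := (M / c) ^ (1 / p.toReal) with hD
  have hD0 : 0 ≤ D := by positivity
  -- The `L^p` norm of `u` is at most that of `f` plus that of `u - f`, contributing `1 + A * (D +
  -- 1)` via Poincaré; the gradient contributes `D`.
  refine ⟨1 + A * (D + 1) + D, by positivity, fun f => ?_⟩
  obtain ⟨u, hu⟩ := exists_isEnergyMinimizer hΩb hw hp₁ hp₂ hA hP f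
  have huniq : ∀ v : Sobolev 𝕜 Ω p, IsEnergyMinimizer γ f v → v = u := fun v hv =>
    isEnergyMinimizer_unique hw hp₁ hp₂ hP hv hu
  refine ⟨u, ⟨(isWeakSolution_iff_isEnergyMinimizer hw hp₁ hp₂ f u).mpr hu, fun v hv =>
    huniq v ((isWeakSolution_iff_isEnergyMinimizer hw hp₁ hp₂ f v).mp hv)⟩, ?_, hu, huniq⟩
  -- The function `f` is itself a competitor for the minimum.
  have h1 : ‖grad u‖ ≤ D * ‖grad f‖ :=
    norm_grad_le_of_energy_le hw hM hp₁ hp₂ (hu.2 f (by simp))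
  have h2 : ‖toLp (u - f)‖ ≤ A * (‖grad u‖ + ‖grad f‖) :=
    (hP _ hu.1).trans (mul_le_mul_of_nonneg_left (norm_sub_le (grad u) (grad f)) hA)
  have h3 : ‖toLp u‖ ≤ ‖toLp f‖ + ‖toLp (u - f)‖ := norm_le_norm_add_norm_sub' (toLp u) (toLp f)
  have h4 := norm_sobolev_le u
  have h5 := norm_toLp_le f
  have h6 := norm_grad_le f
  have h7 : ‖grad u‖ ≤ D * ‖f‖ := h1.trans (by gcongr)
  have h8 : A * (‖grad u‖ + ‖grad f‖) ≤ A * (D * ‖f‖ + ‖f‖) := by gcongr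
  linarith
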